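/- Let $n\ge 3$, $I=(0,1)$, $p\ge 1$, $\lambda\in\mathbb R$, and $\Psi(t)=t^p\log^{\lambda}(e+t)$. For an open set $\Omega\subset\mathbb R^n$, $L^\Psi(\Omega)$ is the set of measurable $u$ with $\int_\Omega\Psi(\alpha|u|)\,dx<\infty$ for some $\alpha>0$, and $W^{1,\Psi}(\Omega)$ is the set of $u\in L^\Psi(\Omega)$ whose weak partial derivatives (tested against $C^1_0(\Omega)$) all belong to $L^\Psi(\Omega)$. A compact set $E\subset\mathbb R^{n-1}=\mathbb R^{n-1}\times\{0\}\subset\mathbb R^n$ is called $(p,\lambda)$-removable if $W^{1,\Psi}(\mathbb R^n\setminus E)=W^{1,\Psi}(\mathbb R^n)$ as sets. For a rectangle $Q$ and $c>0$, $cQ$ denotes the rectangle with the same centre and edge directions whose edge lengths are multiplied by $c$. **Theorem (non-removability, $n\ge 3$).** Let $E\subset\mathbb R^{n-1}$ be compact and suppose that $I^{n-1}\setminus E=\bigcup_i Q_i$ for a finite or countable family of pairwise disjoint sets $Q_i$, where, if $p=n-1$ and $\lambda>n-2$, each $Q_i$ is an open rectangle with one edge of length $r_i$ and all other edges of length $\sqrt2\,r_i^2$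 (for some $r_i>0$), and for the other values of $(p,\lambda)$ each $Q_i$ is an open cube. Write $d_i=\operatorname{diam}Q_i$. Suppose that one of the following holds: (i) $1<p<n-1$, $\lambda\in\mathbb R$; or $p=1$, $\lambda\ge 0$; or $n-1<p<n$, $\lambda\in\mathbb R$; or $p=n-1$, $\lambda\le n-2$; and $$H^{n-1}\Big(I^{n-1}\setminus\bigcup_i 2Q_i\Big)>0,\qquad \sum_i d_i^{\,n-p}\log^{\lambda}(1/d_i)<\infty;$$ (ii) $p=n-1$, $\lambda>n-2$, and $$H^{n-1}\Big(I^{n-1}\setminus\bigcup_i 2Q_i\Big)>0,\qquad \sum_i d_i\log^{\lambda-(n-2)}(1/d_i)<\infty;$$ (iii) $p=n$, $\lambda<n-1$, and $$H^{n-1}\Big((E\cap I^{n-1})\setminus\bigcup_i d_i^{-1/2}Q_i\Big)>0,\qquad \sum_i \log^{\lambda-(n-1)}(1/d_i)<\infty;$$ (iv) $p=n$, $\lambda=n-1$, and, with $R_i=\exp\big(-(\log(1/d_i))^{1/2}\big)$, $$H^{n-1}\Big((E\cap I^{n-1})\setminus\bigcup_i \tfrac{R_i}{d_i}Q_i\Big)>0,\qquad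 \sum_i \big(\log\log(1/d_i)\big)^{1-n}<\infty.$$ Then $E$ is not $(p,\lambda)$-removable. (Only finitely many $Q_i$ have $d_i\ge 1/e$. The corresponding terms of the series, where the logarithmic expressions may be undefined, are disregarded, since finitely many terms do not affect convergence; in (iv) the sets $\frac{R_i}{d_i}Q_i$ with $d_i\ge1$ are also omitted.) -/

import Mathlib

open MeasureTheory

/-! ### Orlicz–Sobolev spaces and removable sets -/

/-- The function `Ψ(t) = t ^ p * log ^ lam (e + t)`, for `t ≥ 0`. -/
noncomputable def orliczPsi (p lam : ℝ) (t : ℝ) : ℝ :=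
  t ^ p * Real.log (Real.exp 1 + t) ^ lam

/-- `u ∈ L^Ψ(Ω)`: `u` is measurable on `Ω` and `∫_Ω Ψ(α |u|) dx < ∞` for some `α > 0`. -/
def MemOrlicz {n : ℕ} (Ψ : ℝ → ℝ) (Ω : Set (EuclideanSpace ℝ (Fin n)))
    (u : EuclideanSpace ℝ (Fin n) → ℝ) : Prop :=
  AEStronglyMeasurable u (volume.restrict Ω) ∧
    ∃ α : ℝ, 0 < α ∧ ∫⁻ x in Ω, ENNReal.ofReal (Ψ (α * |u x|)) < ⊤

/-- `v` is the weak (distributional) `j`-th partial derivative of `u` in the open set `Ω`, tested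
against compactly supported `C¹` functions on `Ω`. -/
def IsWeakPartialDeriv {n : ℕ} (Ω : Set (EuclideanSpace ℝ (Fin n))) (j : Fin n)
    (u v : EuclideanSpace ℝ (Fin n) → ℝ) : Prop :=
  LocallyIntegrableOn u Ω ∧ LocallyIntegrableOn v Ω ∧
    ∀ φ : EuclideanSpace ℝ (Fin n) → ℝ, ContDiff ℝ 1 φ → HasCompactSupport φ → tsupport φ ⊆ Ω →
      ∫ x in Ω, u x * fderiv ℝ φ x (EuclideanSpace.single j 1) = -∫ x in Ω, φ x * v x

/-- `u ∈ W^{1,Ψ}(Ω)`: `u` and its weak partial derivatives belong to `L^Ψ(Ω)`. Only the values of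
`u` almost everywhere on `Ω` matter. -/
def MemOrliczSobolev {n : ℕ} (Ψ : ℝ → ℝ) (Ω : Set (EuclideanSpace ℝ (Fin n)))
    (u : EuclideanSpace ℝ (Fin n) → ℝ) : Prop :=
  MemOrlicz Ψ Ω u ∧ ∀ j : Fin n, ∃ v, MemOrlicz Ψ Ω v ∧ IsWeakPartialDeriv Ω j u v

/-- Removability for `W^{1,Ψ}` of a closed set `F ⊆ ℝⁿ` of zero Lebesgue measure:
`W^{1,Ψ}(ℝⁿ \ F) = W^{1,Ψ}(ℝⁿ)`. -/
def IsOrliczSobolevRemovable {n : ℕ} (Ψ : ℝ → ℝ) (F : Set (EuclideanSpace ℝ (Fin n))) : Prop :=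
  ∀ u : EuclideanSpace ℝ (Fin n) → ℝ,
    MemOrliczSobolev Ψ Fᶜ u ↔ MemOrliczSobolev Ψ Set.univ u

/-- The embedding `ℝⁿ⁻¹ → ℝⁿ`, `x' ↦ (x', 0)`. -/
noncomputable def hyperplaneEmb (n : ℕ) (x : EuclideanSpace ℝ (Fin (n - 1))) :
    EuclideanSpace ℝ (Fin n) :=
  WithLp.toLp 2 fun i => if h : (i : ℕ) < n - 1 then x ⟨i, h⟩ else 0

/-- `E ⊆ ℝⁿ⁻¹ ⊆ ℝⁿ` is `(p, lam)`-removable: it is removable for `W^{1,Ψ}` in `ℝⁿ`, where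
`Ψ(t) = t ^ p * log ^ lam (e + t)`. -/
def IsPLRemovable (n : ℕ) (p lam : ℝ) (E : Set (EuclideanSpace ℝ (Fin (n - 1)))) : Prop :=
  IsOrliczSobolevRemovable (orliczPsi p lam) (hyperplaneEmb n '' E)

/-! ### Cubes and rectangles -/

/-- The open unit cube `I^k = (0,1)^k`. -/
def openUnitCube (k : ℕ) : Set (EuclideanSpace ℝ (Fin k)) :=
  {x | ∀ j, x j ∈ Set.Ioo (0 : ℝ) 1}

/-- The data of an open rectangle in `ℝ^k`: its centre, the (orthonormal) directions of its edges,
and its positive edge lengths. -/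
structure OpenRectangle (k : ℕ) where
  center : EuclideanSpace ℝ (Fin k)
  frame : OrthonormalBasis (Fin k) ℝ (EuclideanSpace ℝ (Fin k))
  edge : Fin k → ℝ
  edge_pos : ∀ j, 0 < edge j

namespace OpenRectangle

variable {k : ℕ}

/-- The rectangle `c Q`: same centre and directions as `Q`, edge lengths multiplied by `c`. -/
def dilate (Q : OpenRectangle k) (c : ℝ) : Set (EuclideanSpace ℝ (Fin k)) :=
  {x | ∀ j, |inner ℝ (Q.frame j) (x - Q.center)| < c * Q.edge j / 2}

/-- The rectangle `Q` as a set of points. -/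
def toSet (Q : OpenRectangle k) : Set (EuclideanSpace ℝ (Fin k)) :=
  {x | ∀ j, |inner ℝ (Q.frame j) (x - Q.center)| < Q.edge j / 2}

/-- The diameter of `Q`. -/
noncomputable def diam (Q : OpenRectangle k) : ℝ := Metric.diam Q.toSet

/-- `Q` is a cube: all edges have the same length. -/
def IsCube (Q : OpenRectangle k) : Prop := ∃ l : ℝ, ∀ j, Q.edge j = l

/-- One edge of `Q` has length `r`, all the others have length `√2 r²`. -/
def IsThin (Q : OpenRectangle k) (r : ℝ) : Prop :=
  ∃ j₀, Q.edge j₀ = r ∧ ∀ j, j ≠ j₀ → Q.edge j = √2 * r ^ 2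

/-- `R = exp (-(log (1 / diam Q)) ^ (1/2))`. -/
noncomputable def expRadius (Q : OpenRectangle k) : ℝ :=
  Real.exp (-√(Real.log (1 / Q.diam)))

end OpenRectangle

/-! Non-removability is shown by one function `u` that vanishes for `t ≤ 0`, equals `ζ * (1 - B)`
for `t > 0`, and jumps across `E`. Here `ζ` is a smooth cutoff and `B` is the supremum of bumps `b
i`, one around each hole `Q i`, equal to `1` near the hole. Near a hole `u` therefore vanishes on
both sides of the hyperplane, so `u` is locally Lipschitz off `E`. There its gradient is bounded by
a constant plus the Lipschitz bound of a single bump, so its energy is at most a constant plus the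
sum of the energies of the bumps. That sum is what the hypotheses on the series make finite.

On the set `S ⊆ E` of positive measure `B` stays below `1`, and each bump is largest on the
hyperplane. So `u` has a positive limiting gap above `S`, and testing a putative weak vertical
derivative on cutoffs that shrink to the hyperplane gives a contradiction
(`not_isWeakPartialDeriv_of_jump`). This mechanism is `not_isOrliczSobolevRemovable_of_barrier`;
finitely many holes may be ignored by localizing `ζ` away from them.

The bumps are nearly extremal for the `Ψ`-capacity of a hole. In coordinates adapted to a cube `Q i`
it is a ball of the sup norm, and a function of that norm suffices. Three profiles occur: linear,
with energy about `d ^ (n - p) * log ^ lam (1 / d)`; logarithmic for `p = n`, with energy about `log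
^ (lam - (n - 1)) (1 / d)`; and doubly logarithmic for `p = n`, `lam = n - 1`, with energy about
`(log log (1 / d)) ^ (1 - n)`. Each bump vanishes off the dilated cube of the statement, so `B = 0`
on `S` up to finitely many holes.

For a thin rectangle with `p = n - 1`, the slices orthogonal to the long edge have dimension `n - 1
= p`, the critical one. The bump is the minimum of a logarithmic bump in the slice and a linear one
along the long edge; its energy is about `r * log ^ (lam - (n - 2)) (1 / r)`. It reaches beyond
`2Q`, where it is only `< 1`. The lengths `r` are summable, so by Borel-Cantelli almost every point
of `S` meets finitely many supports, and `B < 1` there. -/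

open Filter Topology Metric Set
open scoped NNReal ENNReal

/-! ### Weak derivatives of locally Lipschitz functions -/

section WeakDerivative

variable {n : ℕ} {Ω : Set (EuclideanSpace ℝ (Fin n))} {u : EuclideanSpace ℝ (Fin n) → ℝ}

/-- A compact subset of an open set on which `u` is locally Lipschitz has a neighbourhood on which
`u` agrees with a globally Lipschitz function. -/
theorem exists_lipschitzWith_eventuallyEq_of_locallyLipschitzOn (hΩ : IsOpen Ω)
    (hu : ∀ x ∈ Ω, ∃ K : ℝ≥0, ∃ U ∈ 𝓝 x, LipschitzOnWith K u U)
    {T : Set (EuclideanSpace ℝ (Fin n))} (hT : IsCompact T) (hTΩ : T ⊆ Ω) :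
    ∃ K : ℝ≥0, ∃ g : EuclideanSpace ℝ (Fin n) → ℝ, LipschitzWith K g ∧ ∀ x ∈ T, g =ᶠ[𝓝 x] u := by
  obtain ⟨N, hN, hTN, hNΩ⟩ := exists_compact_between hT hΩ hTΩ
  obtain ⟨K, hK⟩ := LocallyLipschitzOn.exists_lipschitzOnWith_of_compact (f := u) hN (by
    intro x hx
    obtain ⟨K, U, hU, hK⟩ := hu x (hNΩ hx)
    exact ⟨K, U, mem_nhdsWithin_of_mem_nhds hU, hK⟩)
  obtain ⟨g, hg, hgu⟩ := hK.extend_real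
  refine ⟨K, g, hg, fun x hx => ?_⟩
  filter_upwards [isOpen_interior.mem_nhds (hTN hx)] with y hy
  exact (hgu (interior_subset hy)).symm

/-- A locally Lipschitz function has its classical partial derivatives as weak partial
derivatives. -/
theorem isWeakPartialDeriv_of_locallyLipschitzOn (hΩ : IsOpen Ω)
    (hu : ∀ x ∈ Ω, ∃ K : ℝ≥0, ∃ U ∈ 𝓝 x, LipschitzOnWith K u U) (j : Fin n) :
    IsWeakPartialDeriv Ω j u (fun x => fderiv ℝ u x (EuclideanSpace.single j 1)) := by
  have hcont : ContinuousOn u Ω := fun x hx => by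
    obtain ⟨K, U, hU, hK⟩ := hu x hx
    exact (hK.continuousOn.continuousAt hU).continuousWithinAt
  refine ⟨hcont.locallyIntegrableOn hΩ.measurableSet, ?_, ?_⟩
  · intro x hx
    obtain ⟨K, U, hU, hK⟩ := hu x hx
    obtain ⟨r, hr, hrU⟩ := Metric.mem_nhds_iff.1 hU
    refine ⟨ball x r, mem_nhdsWithin_of_mem_nhds (ball_mem_nhds x hr), ?_⟩
    refine Measure.integrableOn_of_bounded (M := K) measure_ball_lt_top.ne
      (measurable_fderiv_apply_const ℝ u _).aestronglyMeasurable ?_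
    filter_upwards [ae_restrict_mem measurableSet_ball] with y hy
    have h1 : ‖fderiv ℝ u y‖ ≤ K :=
      norm_fderiv_le_of_lipschitzOn ℝ (mem_of_superset (isOpen_ball.mem_nhds hy) hrU) hK
    calc _ ≤ ‖fderiv ℝ u y‖ * ‖EuclideanSpace.single j (1 : ℝ)‖ := ContinuousLinearMap.le_opNorm _ _
      _ ≤ K := by simpa using h1
  · intro φ hφ hφc hφΩ
    obtain ⟨K, g, hg, hgu⟩ := exists_lipschitzWith_eventuallyEq_of_locallyLipschitzOn hΩ hu hφc hφΩ
    obtain ⟨D, hD⟩ := hφ.lipschitzWith_of_hasCompactSupport hφc one_ne_zero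
    -- Integration by parts for Lipschitz functions, which rests on Rademacher's theorem. Both
    -- integrands vanish off the support of `φ`, near which `g` and `u` agree.
    have key := hg.integral_lineDeriv_mul_eq (μ := volume) hD hφc (EuclideanSpace.single j 1)
    have hz : ∀ x, x ∉ tsupport φ → fderiv ℝ φ x = 0 := fun x hx => by
      have : φ =ᶠ[𝓝 x] fun _ => 0 := notMem_tsupport_iff_eventuallyEq.1 hx
      rw [this.fderiv_eq]; simp
    have e1 : ∫ x in Ω, u x * fderiv ℝ φ x (EuclideanSpace.single j 1)
        = -∫ x, lineDeriv ℝ φ x (-EuclideanSpace.single j 1) * g x := by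
      rw [setIntegral_eq_integral_of_forall_compl_eq_zero, ← integral_neg]
      · refine integral_congr_ae (Eventually.of_forall fun x => ?_)
        simp only
        rw [(hφ.differentiable one_ne_zero x).lineDeriv_eq_fderiv]
        by_cases hx : x ∈ tsupport φ
        · rw [(hgu x hx).self_of_nhds]; simp [mul_comm]
        · simp [hz x hx]
      · intro x hx
        simp [hz x (fun h => hx (hφΩ h))]
    rw [e1, ← key]
    congr 1
    rw [setIntegral_eq_integral_of_forall_compl_eq_zero]
    · refine integral_congr_ae ?_
      filter_upwards [hg.ae_differentiableAt] with x hx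
      by_cases hxs : x ∈ tsupport φ
      · rw [hx.lineDeriv_eq_fderiv, (hgu x hxs).fderiv_eq, mul_comm]
      · simp [image_eq_zero_of_notMem_tsupport hxs]
    · intro x hx
      simp [image_eq_zero_of_notMem_tsupport (fun h => hx (hφΩ h))]

end WeakDerivative

/-! ### Almost monotonicity of the Orlicz function -/

section OrliczFunction

theorem orliczPsi_nonneg (p lam : ℝ) {t : ℝ} (ht : 0 ≤ t) : 0 ≤ orliczPsi p lam t := by
  refine mul_nonneg (Real.rpow_nonneg ht _) (Real.rpow_nonneg (Real.log_nonneg ?_) _)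
  linarith [Real.add_one_le_exp (1 : ℝ)]

theorem orliczPsi_zero {p : ℝ} (hp : p ≠ 0) (lam : ℝ) : orliczPsi p lam 0 = 0 := by
  simp [orliczPsi, Real.zero_rpow hp]

theorem measurable_orliczPsi (p lam : ℝ) : Measurable (orliczPsi p lam) := by
  unfold orliczPsi
  fun_prop

theorem one_le_log_exp_one_add {t : ℝ} (ht : 0 ≤ t) : 1 ≤ Real.log (Real.exp 1 + t) := by
  rw [Real.le_log_iff_exp_le (by positivity)]
  linarith

/-- `t ^ p * log ^ lam (e + t)` is nondecreasing up to a constant factor. -/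
theorem exists_orliczPsi_le_mul {p : ℝ} (hp : 0 < p) (lam : ℝ) :
    ∃ C : ℝ, 0 ≤ C ∧ ∀ s t, 0 ≤ s → s ≤ t → orliczPsi p lam s ≤ C * orliczPsi p lam t := by
  rcases le_or_gt 0 lam with hl | hl
  · refine ⟨1, zero_le_one, fun s t hs hst => ?_⟩
    rw [one_mul]
    unfold orliczPsi
    have := one_le_log_exp_one_add hs
    have ht := Real.rpow_nonneg (hs.trans hst) p
    gcongr
  · set ε := p / (-lam) with hε
    have hεp : 0 < ε := div_pos hp (by linarith)
    set K := max 1 ε⁻¹ with hK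
    have hK0 : 0 < K := lt_max_of_lt_left one_pos
    refine ⟨K ^ (-lam), by positivity, fun s t hs hst => ?_⟩
    rcases hs.eq_or_lt with rfl | hs
    · rw [orliczPsi_zero hp.ne']
      exact mul_nonneg (by positivity) (orliczPsi_nonneg _ _ hst)
    have ht : 0 < t := hs.trans_le hst
    have hx : 1 ≤ t / s := (one_le_div hs).2 hst
    have h1 : 1 + Real.log (t / s) ≤ K * (t / s) ^ ε := by
      have := Real.log_le_sub_one_of_pos (x := (t / s) ^ ε) (by positivity)
      rw [Real.log_rpow (by positivity)] at this
      have h2 : Real.log (t / s) ≤ ε⁻¹ * ((t / s) ^ ε - 1) := by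
        rw [inv_mul_eq_div, le_div_iff₀ hεp]; linarith
      have h3 : 0 ≤ (t / s) ^ ε - 1 := by
        have := Real.one_le_rpow hx hεp.le; linarith
      have h4 : ε⁻¹ * ((t / s) ^ ε - 1) ≤ K * ((t / s) ^ ε - 1) :=
        mul_le_mul_of_nonneg_right (le_max_right _ _) h3
      have h5 : 1 ≤ K := le_max_left _ _
      linarith
    have hls := one_le_log_exp_one_add hs.le
    have hlt := one_le_log_exp_one_add ht.le
    have h2 : Real.log (Real.exp 1 + t) ≤
        Real.log (Real.exp 1 + s) * (K * (t / s) ^ ε) := by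
      have : Real.log (Real.exp 1 + t) ≤ Real.log (Real.exp 1 + s) + Real.log (t / s) := by
        rw [← Real.log_mul (by positivity) (by positivity)]
        apply Real.log_le_log (by positivity)
        rw [add_mul, mul_div_cancel₀ _ hs.ne']
        have := le_mul_of_one_le_right (Real.exp_pos 1).le hx
        linarith
      have h0 : 0 ≤ Real.log (t / s) := Real.log_nonneg hx
      calc _ ≤ Real.log (Real.exp 1 + s) * (1 + Real.log (t / s)) := by nlinarith
        _ ≤ _ := by gcongr
    have h3 : Real.log (Real.exp 1 + t) ^ (-lam) ≤
        Real.log (Real.exp 1 + s) ^ (-lam) * (K ^ (-lam) * (t / s) ^ p) := by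
      calc _ ≤ (Real.log (Real.exp 1 + s) * (K * (t / s) ^ ε)) ^ (-lam) :=
            Real.rpow_le_rpow (by linarith) h2 (by linarith)
        _ = _ := by
          rw [Real.mul_rpow (by linarith) (by positivity), Real.mul_rpow hK0.le (by positivity),
            ← Real.rpow_mul (by positivity), hε, div_mul_cancel₀ _ (by linarith)]
    unfold orliczPsi
    have hlsp : 0 < Real.log (Real.exp 1 + s) := by linarith
    have hltp : 0 < Real.log (Real.exp 1 + t) := by linarith
    rw [Real.rpow_neg hlsp.le, Real.rpow_neg hltp.le, Real.div_rpow ht.le hs.le] at h3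
    have a1 : 0 < Real.log (Real.exp 1 + s) ^ lam := by positivity
    have a2 : 0 < Real.log (Real.exp 1 + t) ^ lam := by positivity
    have a3 : 0 < s ^ p := by positivity
    have a4 : 0 < t ^ p := by positivity
    rw [inv_mul_eq_div, le_div_iff₀ a1, inv_mul_eq_div, div_le_iff₀ a2] at h3
    have := mul_le_mul_of_nonneg_left h3 a3.le
    calc _ = s ^ p * Real.log (Real.exp 1 + s) ^ lam := rfl
      _ ≤ s ^ p * (K ^ (-lam) * (t ^ p / s ^ p) * Real.log (Real.exp 1 + t) ^ lam) := this
      _ = _ := by field_simp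

end OrliczFunction

/-! ### The splitting of space into hyperplane and vertical axis -/

section Coordinates

variable {m : ℕ}

/-- The horizontal part `x'` of `x = (x', t)`. -/
noncomputable def horizontal (x : EuclideanSpace ℝ (Fin (m + 1))) : EuclideanSpace ℝ (Fin m) :=
  WithLp.toLp 2 fun i => x i.castSucc

/-- The vertical coordinate `t` of `x = (x', t)`. -/
def vertical (x : EuclideanSpace ℝ (Fin (m + 1))) : ℝ := x (Fin.last m)

@[fun_prop]
theorem contDiff_horizontal {k : WithTop ℕ∞} :
    ContDiff ℝ k (horizontal : EuclideanSpace ℝ (Fin (m + 1)) → _) := by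
  unfold horizontal
  rw [contDiff_euclidean]
  intro i
  simp only
  fun_prop

@[fun_prop]
theorem contDiff_vertical {k : WithTop ℕ∞} :
    ContDiff ℝ k (vertical : EuclideanSpace ℝ (Fin (m + 1)) → ℝ) := by
  unfold vertical
  fun_prop

@[fun_prop]
theorem continuous_horizontal : Continuous (horizontal : EuclideanSpace ℝ (Fin (m + 1)) → _) :=
  (contDiff_horizontal (k := 0)).continuous

@[fun_prop]
theorem continuous_vertical : Continuous (vertical : EuclideanSpace ℝ (Fin (m + 1)) → ℝ) :=
  (contDiff_vertical (k := 0)).continuous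

theorem horizontal_hyperplaneEmb (q : EuclideanSpace ℝ (Fin m)) :
    horizontal (hyperplaneEmb (m + 1) q) = q := by
  ext i
  simp [horizontal, hyperplaneEmb]

theorem vertical_hyperplaneEmb (q : EuclideanSpace ℝ (Fin m)) :
    vertical (hyperplaneEmb (m + 1) q) = 0 := by
  simp [vertical, hyperplaneEmb]

theorem ext_horizontal_vertical {x y : EuclideanSpace ℝ (Fin (m + 1))}
    (h : horizontal x = horizontal y) (h' : vertical x = vertical y) : x = y := by
  ext i
  refine Fin.lastCases h' (fun j => ?_) i
  simpa [horizontal] using congrArg (fun z => z j) h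

theorem hyperplaneEmb_horizontal {x : EuclideanSpace ℝ (Fin (m + 1))} (h : vertical x = 0) :
    hyperplaneEmb (m + 1) (horizontal x) = x :=
  ext_horizontal_vertical (horizontal_hyperplaneEmb _) ((vertical_hyperplaneEmb _).trans h.symm)

theorem continuous_hyperplaneEmb :
    Continuous (hyperplaneEmb (m + 1) : EuclideanSpace ℝ (Fin m) → _) := by
  have : Continuous fun (q : EuclideanSpace ℝ (Fin m)) (i : Fin (m + 1)) =>
      if h : (i : ℕ) < m then q ⟨i, h⟩ else 0 := by
    refine continuous_pi fun i => ?_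
    split_ifs <;> fun_prop
  exact (PiLp.continuous_toLp 2 _).comp this

theorem measurePreserving_horizontal_vertical :
    MeasurePreserving (fun x : EuclideanSpace ℝ (Fin (m + 1)) => (horizontal x, vertical x))
      volume (volume.prod volume) := by
  have h1 := PiLp.volume_preserving_ofLp (Fin (m + 1))
  have h2 := volume_preserving_piFinSuccAbove (fun _ : Fin (m + 1) => ℝ) (Fin.last m)
  have h3 : MeasurePreserving (Prod.map id (WithLp.toLp 2 : (Fin m → ℝ) → _))
      ((volume : Measure ℝ).prod volume) (volume.prod volume) :=
    (MeasurePreserving.id volume).prod (PiLp.volume_preserving_toLp (Fin m))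
  have h4 := (Measure.measurePreserving_swap (μ := (volume : Measure ℝ))
    (ν := (volume : Measure (EuclideanSpace ℝ (Fin m))))).comp (h3.comp (h2.comp h1))
  have h5 : (fun x : EuclideanSpace ℝ (Fin (m + 1)) => (horizontal x, vertical x)) =
      Prod.swap ∘ (Prod.map id (WithLp.toLp 2) ∘
        MeasurableEquiv.piFinSuccAbove (fun _ => ℝ) (Fin.last m) ∘ WithLp.ofLp) := by
    funext x
    refine Prod.ext ?_ ?_
    · ext i
      simp [horizontal, Fin.snocEquiv, Fin.init]
    · simp [vertical, Fin.snocEquiv]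
  rw [h5]
  exact h4

theorem volume_vertical_eq_zero :
    volume {x : EuclideanSpace ℝ (Fin (m + 1)) | vertical x = 0} = 0 := by
  have := (measurePreserving_horizontal_vertical (m := m)).measure_preimage
    (s := univ ×ˢ {0}) (MeasurableSet.univ.prod (measurableSet_singleton _)).nullMeasurableSet
  rw [Measure.prod_prod] at this
  simpa [preimage, Set.mem_prod] using this

end Coordinates

/-! ### A jump across the hyperplane excludes a weak vertical derivative -/

section Jump

variable {m : ℕ}

theorem norm_sq_eq_horizontal_vertical (x : EuclideanSpace ℝ (Fin (m + 1))) :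
    ‖x‖ ^ 2 = ‖horizontal x‖ ^ 2 + vertical x ^ 2 := by
  rw [EuclideanSpace.norm_sq_eq, EuclideanSpace.norm_sq_eq, Fin.sum_univ_castSucc]
  simp [horizontal, vertical]

theorem hasCompactSupport_horizontal_mul_vertical {η : EuclideanSpace ℝ (Fin m) → ℝ} {θ : ℝ → ℝ}
    (hη : HasCompactSupport η) (hθ : HasCompactSupport θ) :
    HasCompactSupport fun x : EuclideanSpace ℝ (Fin (m + 1)) =>
      η (horizontal x) * θ (vertical x) := by
  obtain ⟨R, hR⟩ := hη.isCompact.isBounded.exists_norm_le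
  obtain ⟨T, hT⟩ := hθ.isCompact.isBounded.exists_norm_le
  refine HasCompactSupport.of_support_subset_isCompact
    (isCompact_closedBall 0 √(R ^ 2 + T ^ 2)) fun x hx => ?_
  have h1 : ‖horizontal x‖ ≤ R := hR _ (subset_tsupport _ (left_ne_zero_of_mul hx))
  have h2 : ‖vertical x‖ ≤ T := hT _ (subset_tsupport _ (right_ne_zero_of_mul hx))
  rw [mem_closedBall_zero_iff]
  apply Real.le_sqrt_of_sq_le
  rw [norm_sq_eq_horizontal_vertical, ← sq_abs (vertical x), ← Real.norm_eq_abs]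
  gcongr

theorem fderiv_horizontal_mul_vertical {η : EuclideanSpace ℝ (Fin m) → ℝ} {θ : ℝ → ℝ}
    (hη : ContDiff ℝ 1 η) (hθ : ContDiff ℝ 1 θ) (x : EuclideanSpace ℝ (Fin (m + 1))) :
    fderiv ℝ (fun x : EuclideanSpace ℝ (Fin (m + 1)) => η (horizontal x) * θ (vertical x)) x
      (EuclideanSpace.single (Fin.last m) 1) = η (horizontal x) * deriv θ (vertical x) := by
  have hφ : ContDiff ℝ 1 fun x : EuclideanSpace ℝ (Fin (m + 1)) =>
      η (horizontal x) * θ (vertical x) := by fun_prop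
  have h1 := (hφ.differentiable one_ne_zero x).hasFDerivAt.hasLineDerivAt
    (EuclideanSpace.single (Fin.last m) 1)
  have h2 : HasDerivAt (fun s : ℝ => η (horizontal x) * θ (vertical x + s))
      (η (horizontal x) * deriv θ (vertical x)) 0 := by
    have : HasDerivAt θ (deriv θ (vertical x)) (vertical x + 0) := by
      rw [add_zero]; exact (hθ.differentiable one_ne_zero _).hasDerivAt
    exact (this.comp_const_add (vertical x) 0).const_mul _
  refine HasDerivAt.unique h1 (h2.congr_of_eventuallyEq (Eventually.of_forall fun s => ?_))
  have e1 : horizontal (x + s • EuclideanSpace.single (Fin.last m) 1) = horizontal x := by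
    ext i
    simp [horizontal]
  have e2 : vertical (x + s • EuclideanSpace.single (Fin.last m) 1) = vertical x + s := by
    simp [vertical]
  simp only [e1, e2]

theorem integral_horizontal_mul_vertical {f : EuclideanSpace ℝ (Fin m) → ℝ} {g : ℝ → ℝ}
    (hf : Measurable f) (hg : Measurable g) :
    ∫ x : EuclideanSpace ℝ (Fin (m + 1)), f (horizontal x) * g (vertical x) =
      (∫ y, f y) * ∫ t, g t := by
  rw [← integral_prod_mul f g, ← measurePreserving_horizontal_vertical.map_eq,
    integral_map measurePreserving_horizontal_vertical.measurable.aemeasurable]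
  exact Measurable.aestronglyMeasurable (by fun_prop)

theorem integrable_horizontal_mul_vertical {f : EuclideanSpace ℝ (Fin m) → ℝ} {g : ℝ → ℝ}
    (hf : Integrable f) (hg : Integrable g) :
    Integrable fun x : EuclideanSpace ℝ (Fin (m + 1)) => f (horizontal x) * g (vertical x) :=
  (measurePreserving_horizontal_vertical (m := m)).integrable_comp_of_integrable (hf.mul_prod hg)

/-- A smooth cutoff equal to `1` on `[-1/a, 1/a]` and vanishing off `[-2/a, 2/a]`. -/
noncomputable def intervalCutoff (a t : ℝ) : ℝ :=
  Real.smoothTransition (2 - a * t) * Real.smoothTransition (2 + a * t)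

theorem contDiff_intervalCutoff (a : ℝ) : ContDiff ℝ 1 (intervalCutoff a) := by
  unfold intervalCutoff
  have h := Real.smoothTransition.contDiff (n := 1)
  exact (h.comp (by fun_prop)).mul (h.comp (by fun_prop))

theorem intervalCutoff_nonneg (a t : ℝ) : 0 ≤ intervalCutoff a t :=
  mul_nonneg (Real.smoothTransition.nonneg _) (Real.smoothTransition.nonneg _)

theorem intervalCutoff_le_one (a t : ℝ) : intervalCutoff a t ≤ 1 :=
  mul_le_one₀ (Real.smoothTransition.le_one _) (Real.smoothTransition.nonneg _)
    (Real.smoothTransition.le_one _)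

theorem intervalCutoff_eq_zero {a t : ℝ} (h : 2 ≤ |a * t|) : intervalCutoff a t = 0 := by
  unfold intervalCutoff
  rcases le_abs'.1 h with h | h
  · rw [Real.smoothTransition.zero_of_nonpos (x := 2 + a * t) (by linarith), mul_zero]
  · rw [Real.smoothTransition.zero_of_nonpos (x := 2 - a * t) (by linarith), zero_mul]

theorem intervalCutoff_eq_one {a t : ℝ} (h : |a * t| ≤ 1) : intervalCutoff a t = 1 := by
  unfold intervalCutoff
  rw [abs_le] at h
  rw [Real.smoothTransition.one_of_one_le (by linarith),
    Real.smoothTransition.one_of_one_le (by linarith), mul_one]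

theorem intervalCutoff_zero (a : ℝ) : intervalCutoff a 0 = 1 := intervalCutoff_eq_one (by simp)

theorem hasCompactSupport_intervalCutoff {a : ℝ} (ha : 0 < a) :
    HasCompactSupport (intervalCutoff a) := by
  refine HasCompactSupport.of_support_subset_isCompact (isCompact_closedBall 0 (2 / a))
    fun t ht => ?_
  rw [mem_closedBall_zero_iff, Real.norm_eq_abs, le_div_iff₀ ha]
  by_contra! h
  exact ht (intervalCutoff_eq_zero (by rw [abs_mul, abs_of_pos ha]; linarith))

theorem deriv_intervalCutoff_nonpos {a t : ℝ} (ha : 0 < a) (ht : 0 < t) :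
    deriv (intervalCutoff a) t ≤ 0 := by
  have h : intervalCutoff a =ᶠ[𝓝 t] fun t => Real.smoothTransition (2 - a * t) := by
    filter_upwards [lt_mem_nhds ht] with s hs
    have := mul_pos ha hs
    rw [intervalCutoff, Real.smoothTransition.one_of_one_le (x := 2 + a * s) (by linarith), mul_one]
  rw [h.deriv_eq]
  refine Antitone.deriv_nonpos fun s s' hs => Real.smoothTransition.monotone ?_
  nlinarith

theorem deriv_intervalCutoff_eq_zero {a t : ℝ} (h : 2 < |a * t|) :
    deriv (intervalCutoff a) t = 0 := by
  have h : intervalCutoff a =ᶠ[𝓝 t] fun t => 0 := by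
    have hc : Continuous fun s : ℝ => |a * s| := by fun_prop
    filter_upwards [hc.continuousAt.eventually (lt_mem_nhds h)] with s hs
    exact intervalCutoff_eq_zero hs.le
  rw [h.deriv_eq, deriv_const]

/-- A function which vanishes below the hyperplane `{t = 0}` and stays above a positive amount just
above it has no weak vertical derivative. -/
theorem not_isWeakPartialDeriv_of_jump {u : EuclideanSpace ℝ (Fin (m + 1)) → ℝ}
    (hum : Measurable u) {M : ℝ} (huM : ∀ x, |u x| ≤ M) (hu0 : ∀ x, vertical x ≤ 0 → u x = 0)
    {κ η : EuclideanSpace ℝ (Fin m) → ℝ} (hκm : Measurable κ) (hκ0 : ∀ y, 0 ≤ κ y)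
    (hκM : ∀ y, κ y ≤ M)
    (hκ : ∀ x, 0 < vertical x → vertical x < 1 → κ (horizontal x) ≤ u x)
    (hη : ContDiff ℝ 1 η) (hηc : HasCompactSupport η) (hη0 : ∀ y, 0 ≤ η y)
    (hpos : 0 < ∫ y, η y * κ y) (v : EuclideanSpace ℝ (Fin (m + 1)) → ℝ) :
    ¬ IsWeakPartialDeriv univ (Fin.last m) u v := by
  rintro ⟨-, hv, hvφ⟩
  -- The shift by `3` keeps the supports inside `|t| ≤ 2 / 3`, hence in the strip `|t| < 1` where
  -- the lower bound on `u` holds.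
  set φ : ℕ → EuclideanSpace ℝ (Fin (m + 1)) → ℝ := fun k x =>
    η (horizontal x) * intervalCutoff (k + 3) (vertical x) with hφ
  have hk3 : ∀ k : ℕ, (0 : ℝ) < k + 3 := fun k => by positivity
  have hφc : ∀ k, HasCompactSupport (φ k) := fun k =>
    hasCompactSupport_horizontal_mul_vertical hηc (hasCompactSupport_intervalCutoff (hk3 k))
  have hφd : ∀ k, ContDiff ℝ 1 (φ k) := fun k => by
    have := contDiff_intervalCutoff (k + 3)
    fun_prop
  obtain ⟨B, hB⟩ := hηc.exists_bound_of_continuous hη.continuous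
  have hlow : ∀ k, ∫ y, η y * κ y ≤ ∫ x, φ k x * v x := fun k => by
    have h := hvφ (φ k) (hφd k) (hφc k) (subset_univ _)
    simp only [Measure.restrict_univ] at h
    rw [← neg_neg (∫ x, φ k x * v x), ← h, ← integral_neg]
    -- The half of `-θ'` on `t > 0` has integral `θ 0 = 1` whatever `k` is, so the bound from below
    -- does not decay as the cutoffs shrink.
    set g : ℝ → ℝ := (Ioi (0 : ℝ)).indicator fun t => -deriv (intervalCutoff (k + 3)) t with hg
    have hdc := (contDiff_intervalCutoff (k + 3)).continuous_deriv le_rfl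
    have hdi : Integrable (deriv (intervalCutoff (k + 3))) :=
      hdc.integrable_of_hasCompactSupport (hasCompactSupport_intervalCutoff (hk3 k)).deriv
    have hg1 : ∫ t, g t = 1 := by
      rw [hg, integral_indicator measurableSet_Ioi, integral_neg,
        HasCompactSupport.integral_Ioi_deriv_eq (contDiff_intervalCutoff _)
          (hasCompactSupport_intervalCutoff (hk3 k)), intervalCutoff_zero, neg_neg]
    have hgm : Measurable g := hdc.measurable.neg.indicator measurableSet_Ioi
    have hmul := integral_horizontal_mul_vertical (m := m) (f := fun y => η y * κ y)
      (hη.continuous.measurable.mul hκm) hgm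
    rw [hg1, mul_one] at hmul
    rw [← hmul]
    have hηi : Integrable η := hη.continuous.integrable_of_hasCompactSupport hηc
    refine integral_mono ?_ ?_ fun x => ?_
    · refine integrable_horizontal_mul_vertical (f := fun y => η y * κ y) ?_
        (hdi.neg.indicator measurableSet_Ioi)
      refine hηi.mul_bdd (c := M) hκm.aestronglyMeasurable (Eventually.of_forall fun y => ?_)
      rw [Real.norm_eq_abs, abs_of_nonneg (hκ0 y)]
      exact hκM y
    · refine Integrable.neg ?_
      refine Integrable.bdd_mul (c := M) ?_ hum.aestronglyMeasurable
        (Eventually.of_forall fun x => huM x)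
      refine Continuous.integrable_of_hasCompactSupport ?_ ?_
      · exact ((hφd k).continuous_fderiv one_ne_zero).clm_apply continuous_const
      · exact (hφc k).fderiv_apply ℝ _
    · have hfd := fderiv_horizontal_mul_vertical hη (contDiff_intervalCutoff (k + 3)) x
      simp only [hφ, hfd]
      rcases le_or_gt (vertical x) 0 with ht | ht
      · rw [hu0 x ht, hg, indicator_of_notMem (by simpa using ht)]; simp
      · rw [hg, indicator_of_mem (by simpa using ht)]
        have hd := deriv_intervalCutoff_nonpos (hk3 k) ht
        rcases lt_or_ge (vertical x) 1 with h1 | h1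
        · have := mul_le_mul_of_nonneg_left (hκ x ht h1)
            (mul_nonneg (hη0 (horizontal x)) (neg_nonneg.2 hd))
          linarith
        · rw [deriv_intervalCutoff_eq_zero]
          · simp
          · rw [abs_of_pos (mul_pos (hk3 k) ht)]
            have : (0 : ℝ) ≤ k := by positivity
            nlinarith
  -- The supports shrink to the null set `{t = 0}`, while all of them lie in the support `K` of the
  -- cutoff with `a = 1`, on which `v` is integrable.
  have hlim : Tendsto (fun k => ∫ x, φ k x * v x) atTop (𝓝 (∫ _ : EuclideanSpace ℝ (Fin (m + 1)), (0 : ℝ))) := by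
    have hK := (hasCompactSupport_horizontal_mul_vertical (m := m) hηc
      (hasCompactSupport_intervalCutoff (a := 1) one_pos)).isCompact
    set K := tsupport fun x : EuclideanSpace ℝ (Fin (m + 1)) =>
      η (horizontal x) * intervalCutoff 1 (vertical x)
    have hvK : IntegrableOn v K := (locallyIntegrableOn_univ.1 hv).integrableOn_isCompact hK
    refine tendsto_integral_of_dominated_convergence (fun x => B * K.indicator (fun x => |v x|) x)
      (fun k => ?_) ?_ (fun k => ?_) ?_
    · exact (hφd k).continuous.aestronglyMeasurable.mul
        (locallyIntegrableOn_univ.1 hv).aestronglyMeasurable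
    · exact ((integrable_indicator_iff hK.measurableSet).2 hvK.abs).const_mul B
    · refine Eventually.of_forall fun x => ?_
      by_cases hx : φ k x = 0
      · simp only [hx, zero_mul, norm_zero]
        exact mul_nonneg ((norm_nonneg _).trans (hB 0)) (indicator_nonneg (fun _ _ => abs_nonneg _) _)
      · have hxK : x ∈ K := by
          refine subset_tsupport _ ?_
          refine mul_ne_zero (left_ne_zero_of_mul hx) ?_
          have h2 := right_ne_zero_of_mul hx
          have h3 : |((k : ℝ) + 3) * vertical x| < 2 := by
            by_contra! h; exact h2 (intervalCutoff_eq_zero h)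
          rw [intervalCutoff_eq_one]
          · exact one_ne_zero
          · rw [abs_mul, abs_of_pos (hk3 k)] at h3
            have : (0 : ℝ) ≤ k := by positivity
            rw [one_mul]
            nlinarith [abs_nonneg (vertical x)]
        rw [indicator_of_mem hxK, norm_mul]
        refine mul_le_mul_of_nonneg_right ?_ (abs_nonneg _)
        rw [hφ, norm_mul, Real.norm_eq_abs (intervalCutoff _ _),
          abs_of_nonneg (intervalCutoff_nonneg _ _)]
        exact (mul_le_of_le_one_right (norm_nonneg _) (intervalCutoff_le_one _ _)).trans (hB _)
    · have hae : ∀ᵐ x : EuclideanSpace ℝ (Fin (m + 1)), vertical x ≠ 0 :=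
        measure_eq_zero_iff_ae_notMem.1 volume_vertical_eq_zero
      filter_upwards [hae] with x hx
      refine tendsto_const_nhds.congr' ?_
      obtain ⟨N, hN⟩ := exists_nat_ge (2 / |vertical x|)
      filter_upwards [eventually_ge_atTop N] with k hk
      rw [hφ]
      simp only
      rw [intervalCutoff_eq_zero, mul_zero, zero_mul]
      have hx' := abs_pos.2 hx
      rw [div_le_iff₀ hx'] at hN
      have : (N : ℝ) ≤ k := by exact_mod_cast hk
      rw [abs_mul, abs_of_pos (hk3 k)]
      nlinarith
  rw [integral_zero] at hlim
  exact absurd (ge_of_tendsto' hlim hlow) (not_le.2 hpos)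

end Jump

/-! ### The barrier criterion for non-removability -/

section Barrier

theorem isOpen_openUnitCube (k : ℕ) : IsOpen (openUnitCube k) := by
  have : openUnitCube k = ⋂ j, {x : EuclideanSpace ℝ (Fin k) | x j ∈ Ioo (0 : ℝ) 1} := by
    ext x; simp [openUnitCube]
  rw [this]
  exact isOpen_iInter_of_finite fun j => isOpen_Ioo.preimage (by fun_prop)

/-- The supremum of countably many functions, finitely many of which are nonzero near `x`, is
Lipschitz near `x` with the largest of their local Lipschitz constants. -/
theorem exists_lipschitzOnWith_iSup {X ι : Type*} [PseudoMetricSpace X] {b : ι → X → ℝ}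
    {G : ι → X → ℝ≥0} (hb0 : ∀ i x, 0 ≤ b i x) (hb1 : ∀ i x, b i x ≤ 1)
    (hG : ∀ i x, ∃ U ∈ 𝓝 x, LipschitzOnWith (G i x) (b i) U)
    {x : X} {V : Set X} (hV : V ∈ 𝓝 x) {J : Set ι} (hJ : J.Finite)
    (hJV : ∀ i ∉ J, ∀ y ∈ V, b i y = 0) :
    ∃ k : ℝ≥0, (k = 0 ∨ ∃ i, k = G i x) ∧
      ∃ U ∈ 𝓝 x, LipschitzOnWith k (fun y => ⨆ i, b i y) U := by
  classical
  choose U hU hL using fun i => hG i x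
  refine ⟨hJ.toFinset.sup fun i => G i x, ?_, V ∩ ⋂ i ∈ J, U i,
    inter_mem hV ((biInter_mem hJ).2 fun i _ => hU i), ?_⟩
  · rcases hJ.toFinset.eq_empty_or_nonempty with h | h
    · left; simp [h]
    · obtain ⟨i, -, hi⟩ := Finset.exists_mem_eq_sup _ h fun i => G i x
      exact Or.inr ⟨i, hi⟩
  · have hbdd : ∀ y, BddAbove (range fun i => b i y) := fun y =>
      ⟨1, by rintro _ ⟨i, rfl⟩; exact hb1 i y⟩
    refine LipschitzOnWith.of_le_add_mul _ fun y hy z hz => ?_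
    have hnn : 0 ≤ ⨆ i, b i z := Real.iSup_nonneg fun i => hb0 i z
    refine Real.iSup_le (fun i => ?_) (by positivity)
    by_cases hi : i ∈ J
    · have h1 := (hL i).le_add_mul (mem_iInter₂.1 hy.2 i hi) (mem_iInter₂.1 hz.2 i hi)
      have h2 : G i x ≤ hJ.toFinset.sup fun i => G i x :=
        Finset.le_sup (f := fun i => G i x) (hJ.mem_toFinset.2 hi)
      have h3 : b i z ≤ ⨆ i, b i z := le_ciSup (hbdd z) i
      have h4 : (G i x : ℝ) * dist y z ≤ (hJ.toFinset.sup fun i => G i x : ℝ≥0) * dist y z := by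
        gcongr
      linarith
    · rw [hJV i hi y hy.1]
      positivity

variable {m : ℕ}

/-- Jump criterion for non-removability: a family of bumps `b i`, equal to `1` near the holes `Q i`
of `E`, of finite total `Ψ`-energy, whose supremum stays below `1` at almost every point of a set
`S ⊆ E` of positive measure. -/
theorem not_isOrliczSobolevRemovable_of_barrier {Ψ : ℝ → ℝ}
    (hΨz : Ψ 0 = 0) (hΨm : Measurable Ψ) {C : ℝ} (hC : 0 ≤ C)
    (hΨC : ∀ s t, 0 ≤ s → s ≤ t → Ψ s ≤ C * Ψ t)
    {E : Set (EuclideanSpace ℝ (Fin m))} (hE : IsCompact E) {ι : Type*} [Countable ι]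
    {Q : ι → Set (EuclideanSpace ℝ (Fin m))} (hcompl : openUnitCube m \ E = ⋃ i, Q i)
    (hQo : ∀ i, IsOpen (Q i)) (hQf : ∀ i, volume (frontier (Q i)) = 0)
    {F : Set ι} (hF : F.Finite) {b : ι → EuclideanSpace ℝ (Fin (m + 1)) → ℝ}
    {G : ι → EuclideanSpace ℝ (Fin (m + 1)) → ℝ≥0} {ρ : ι → ℝ}
    (hb0 : ∀ i x, 0 ≤ b i x) (hb1 : ∀ i x, b i x ≤ 1)
    (hG : ∀ i x, ∃ U ∈ 𝓝 x, LipschitzOnWith (G i x) (b i) U)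
    (hone : ∀ i ∉ F, ∀ q ∈ Q i, ∀ᶠ x in 𝓝 (hyperplaneEmb (m + 1) q), b i x = 1)
    (hmono : ∀ i x, b i x ≤ b i (hyperplaneEmb (m + 1) (horizontal x)))
    (hsupp : ∀ i x, ρ i ≤ |vertical x| → b i x = 0) (hρ : ∀ ε > 0, {i | ε ≤ ρ i}.Finite)
    (hGm : ∀ i, Measurable (G i))
    (henergy : ∑' i, ∫⁻ x, ENNReal.ofReal (Ψ (G i x)) ≠ ⊤)
    {S : Set (EuclideanSpace ℝ (Fin m))} (hSE : S ⊆ E ∩ openUnitCube m) (hS : volume S ≠ 0)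
    (htrace : ∀ᵐ y, y ∈ S → ∃ c < 1, ∀ i, b i (hyperplaneEmb (m + 1) y) ≤ c) :
    ¬ IsOrliczSobolevRemovable Ψ (hyperplaneEmb (m + 1) '' E) := by
  have hbdd : ∀ x, BddAbove (range fun i => b i x) := fun x =>
    ⟨1, by rintro _ ⟨i, rfl⟩; exact hb1 i x⟩
  have hbc : ∀ i, Continuous (b i) := fun i => continuous_iff_continuousAt.2 fun x => by
    obtain ⟨U, hU, hL⟩ := hG i x
    exact hL.continuousOn.continuousAt hU
  set B : EuclideanSpace ℝ (Fin (m + 1)) → ℝ := fun x => ⨆ i, b i x with hB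
  have hBm : Measurable B := Measurable.iSup fun i => (hbc i).measurable
  have hB0 : ∀ x, 0 ≤ B x := fun x => Real.iSup_nonneg fun i => hb0 i x
  have hB1 : ∀ x, B x ≤ 1 := fun x => Real.iSup_le (fun i => hb1 i x) zero_le_one
  have hBmono : ∀ x, B x ≤ B (hyperplaneEmb (m + 1) (horizontal x)) := fun x =>
    Real.iSup_le (fun i => (hmono i x).trans (le_ciSup (hbdd _) i)) (hB0 _)
  -- localization away from the exceptional holes
  have hSQ : ∀ i, ∀ y ∈ S, y ∉ Q i := fun i y hy hyQ => by
    have : y ∈ openUnitCube m \ E := hcompl ▸ mem_iUnion.2 ⟨i, hyQ⟩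
    exact this.2 (hSE hy).1
  set U : Set (EuclideanSpace ℝ (Fin m)) := openUnitCube m \ ⋃ i ∈ F, closure (Q i) with hU
  have hUo : IsOpen U := (isOpen_openUnitCube m).sdiff (hF.isClosed_biUnion fun i _ =>
    isClosed_closure)
  -- Points of `S` avoid the holes, so discarding the closures of finitely many of them costs only
  -- their null frontiers.
  have hSU : volume (S ∩ U) ≠ 0 := by
    intro h0
    refine hS (measure_mono_null (t := (S ∩ U) ∪ ⋃ i ∈ F, frontier (Q i)) ?_ ?_)
    · intro y hy
      by_cases hyU : y ∈ U
      · exact Or.inl ⟨hy, hyU⟩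
      · right
        have : y ∈ ⋃ i ∈ F, closure (Q i) := by
          by_contra h; exact hyU ⟨(hSE hy).2, h⟩
        obtain ⟨i, hi, hyi⟩ := mem_iUnion₂.1 this
        refine mem_iUnion₂.2 ⟨i, hi, hyi, ?_⟩
        rw [(hQo i).interior_eq]
        exact hSQ i y hy
    · exact measure_union_null h0 ((measure_biUnion_null_iff hF.countable).2 fun i _ => hQf i)
  -- `S ∩ U` has positive measure in every neighbourhood of `x₀`, so a cutoff supported near `x₀`
  -- avoids the exceptional holes and still sees the jump.
  obtain ⟨x₀, hx₀, hx₀pos⟩ := exists_mem_forall_mem_nhdsWithin_pos_measure hSU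
  obtain ⟨r, hr, hrU⟩ := nhds_basis_closedBall.mem_iff.1 (hUo.mem_nhds hx₀.2)
  let η : ContDiffBump x₀ := ⟨r / 2, r, by linarith, by linarith⟩
  have hηr : η.rOut = r := rfl
  have hηd : ContDiff ℝ 1 η := η.contDiff
  have hθd := contDiff_intervalCutoff 1
  set ζ : EuclideanSpace ℝ (Fin (m + 1)) → ℝ := fun x =>
    η (horizontal x) * intervalCutoff 1 (vertical x) with hζ
  have hζd : ContDiff ℝ 1 ζ := by fun_prop
  have hζc : HasCompactSupport ζ := hasCompactSupport_horizontal_mul_vertical η.hasCompactSupport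
    (hasCompactSupport_intervalCutoff one_pos)
  have hζ0 : ∀ x, 0 ≤ ζ x := fun x => mul_nonneg η.nonneg (intervalCutoff_nonneg _ _)
  have hζ1 : ∀ x, ζ x ≤ 1 := fun x =>
    mul_le_one₀ η.le_one (intervalCutoff_nonneg _ _) (intervalCutoff_le_one _ _)
  obtain ⟨L, hL⟩ := hζd.lipschitzWith_of_hasCompactSupport hζc one_ne_zero
  set u : EuclideanSpace ℝ (Fin (m + 1)) → ℝ := fun x =>
    if 0 < vertical x then ζ x * (1 - B x) else 0 with hu
  have hum : Measurable u :=
    Measurable.ite (measurableSet_lt measurable_const continuous_vertical.measurable)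
      (hζd.continuous.measurable.mul (measurable_const.sub hBm)) measurable_const
  have hu01 : ∀ x, 0 ≤ u x ∧ u x ≤ 1 := fun x => by
    simp only [hu]
    split_ifs
    · exact ⟨mul_nonneg (hζ0 x) (by linarith [hB1 x]),
        mul_le_one₀ (hζ1 x) (by linarith [hB1 x]) (by linarith [hB0 x])⟩
    · simp
  have huz : ∀ x ∉ tsupport ζ, u x = 0 := fun x hx => by
    simp [hu, image_eq_zero_of_notMem_tsupport hx]
  have hEc : IsClosed (hyperplaneEmb (m + 1) '' E) :=
    (hE.image continuous_hyperplaneEmb).isClosed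
  -- Three regions: below the hyperplane `u` is zero; on it, off `E`, either some bump is
  -- identically `1` nearby or `ζ` vanishes; above it only finitely many bumps reach the height of
  -- `x`, so `B` is locally a finite maximum.
  have hlip : ∀ x ∈ (hyperplaneEmb (m + 1) '' E)ᶜ, ∃ k : ℝ≥0, (k = 0 ∨ ∃ i, k = G i x) ∧
      ∃ V ∈ 𝓝 x, LipschitzOnWith (L + k) u V := by
    intro x hx
    have hzero : (∀ᶠ y in 𝓝 x, u y = 0) → ∃ k : ℝ≥0, (k = 0 ∨ ∃ i, k = G i x) ∧
        ∃ V ∈ 𝓝 x, LipschitzOnWith (L + k) u V := fun h =>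
      ⟨0, Or.inl rfl, _, h, LipschitzOnWith.of_dist_le_mul fun y hy z hz => by
        rw [hy, hz, dist_self]; positivity⟩
    rcases lt_trichotomy (vertical x) 0 with ht | ht | ht
    · refine hzero ?_
      filter_upwards [continuous_vertical.continuousAt.eventually (gt_mem_nhds ht)] with y hy
      simp [hu, hy.le]
    · refine hzero ?_
      by_cases hxr : horizontal x ∈ closedBall x₀ r
      · have hxU := hrU hxr
        have hxE : horizontal x ∉ E := fun h =>
          hx ⟨_, h, hyperplaneEmb_horizontal ht⟩
        have : horizontal x ∈ ⋃ i, Q i := hcompl ▸ ⟨hxU.1, hxE⟩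
        obtain ⟨i, hi⟩ := mem_iUnion.1 this
        have hiF : i ∉ F := fun hiF => hxU.2 (mem_iUnion₂.2 ⟨i, hiF, subset_closure hi⟩)
        have h1 := hone i hiF _ hi
        rw [hyperplaneEmb_horizontal ht] at h1
        filter_upwards [h1] with y hy
        have : B y = 1 := le_antisymm (hB1 y) (hy ▸ le_ciSup (hbdd y) i)
        simp [hu, this]
      · have hcl : IsOpen (closedBall x₀ r)ᶜ := isClosed_closedBall.isOpen_compl
        filter_upwards [continuous_horizontal.continuousAt.eventually (hcl.mem_nhds hxr)] with y hy
        have : η (horizontal y) = 0 := η.zero_of_le_dist (by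
          rw [hηr]; exact (not_le.1 hy).le)
        simp [hu, hζ, this]
    · have hV : {y : EuclideanSpace ℝ (Fin (m + 1)) | vertical x / 2 < vertical y} ∈ 𝓝 x :=
        continuous_vertical.continuousAt.eventually (lt_mem_nhds (by linarith))
      obtain ⟨k, hk, W, hW, hkW⟩ := exists_lipschitzOnWith_iSup hb0 hb1 hG hV
        (hρ (vertical x / 2) (by linarith)) (fun i hi y hy => hsupp i y (by
          rw [mem_ofPred_eq] at hi hy; rw [not_le] at hi
          exact (hi.trans (hy.trans_le (le_abs_self _))).le))
      refine ⟨k, hk, _, inter_mem hV hW, LipschitzOnWith.of_dist_le_mul fun y hy z hz => ?_⟩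
      have hy0 : 0 < vertical y := by have := mem_ofPred_eq ▸ hy.1; linarith
      have hz0 : 0 < vertical z := by have := mem_ofPred_eq ▸ hz.1; linarith
      simp only [hu, hy0, hz0, if_true]
      have h1 := hL.dist_le_mul y z
      have h2 := hkW.dist_le_mul y hy.2 z hz.2
      change dist (B y) (B z) ≤ _ at h2
      rw [Real.dist_eq] at h1 h2 ⊢
      have e : ζ y * (1 - B y) - ζ z * (1 - B z) =
          (ζ y - ζ z) * (1 - B y) - ζ z * (B y - B z) := by ring
      rw [e]
      refine (abs_sub _ _).trans ?_
      rw [abs_mul, abs_mul, abs_of_nonneg (hζ0 z), abs_of_nonneg (by linarith [hB1 y] : 0 ≤ 1 - B y)]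
      have h3 := mul_le_of_le_one_right (abs_nonneg (ζ y - ζ z)) (by linarith [hB0 y] : 1 - B y ≤ 1)
      have h4 := mul_le_of_le_one_left (abs_nonneg (B y - B z)) (hζ1 z)
      push_cast
      linarith
  have hmemu : MemOrliczSobolev Ψ (hyperplaneEmb (m + 1) '' E)ᶜ u := by
    refine ⟨⟨hum.aestronglyMeasurable, 1, one_pos, ?_⟩, fun j =>
      ⟨fun x => fderiv ℝ u x (EuclideanSpace.single j 1),
        ⟨(measurable_fderiv_apply_const ℝ u _).aestronglyMeasurable, 1 / 2, by norm_num, ?_⟩,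
        isWeakPartialDeriv_of_locallyLipschitzOn hEc.isOpen_compl (fun x hx => ?_) j⟩⟩
    · calc _ ≤ ∫⁻ x, (tsupport ζ).indicator (fun _ => ENNReal.ofReal (C * Ψ 1)) x := by
            refine (setLIntegral_le_lintegral _ _).trans (lintegral_mono fun x => ?_)
            by_cases hx : x ∈ tsupport ζ
            · rw [indicator_of_mem hx]
              refine ENNReal.ofReal_le_ofReal (hΨC _ _ (by positivity) ?_)
              rw [one_mul, abs_of_nonneg (hu01 x).1]
              exact (hu01 x).2
            · simp [huz x hx, hΨz]
        _ < ⊤ := by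
            rw [lintegral_indicator_const (isClosed_tsupport ζ).measurableSet]
            exact ENNReal.mul_lt_top ENNReal.ofReal_lt_top hζc.isCompact.measure_lt_top
    · calc _ ≤ ∫⁻ x, ((tsupport ζ).indicator (fun _ => ENNReal.ofReal (C * Ψ L)) x +
              ENNReal.ofReal C * ∑' i, ENNReal.ofReal (Ψ (G i x))) := by
            refine (setLIntegral_mono' hEc.isOpen_compl.measurableSet fun x hx => ?_).trans
              (setLIntegral_le_lintegral _ _)
            by_cases hxζ : x ∈ tsupport ζ
            · rw [indicator_of_mem hxζ]
              obtain ⟨k, hk, V, hV, hkV⟩ := hlip x hx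
              have h1 : |fderiv ℝ u x (EuclideanSpace.single j 1)| ≤ L + k := by
                calc _ ≤ ‖fderiv ℝ u x‖ * ‖EuclideanSpace.single j (1 : ℝ)‖ :=
                      ContinuousLinearMap.le_opNorm _ _
                  _ ≤ L + k := by
                    simpa using norm_fderiv_le_of_lipschitzOn ℝ hV hkV
              -- The choice `α = 1 / 2` turns `L + k` into an average, which is at most the larger
              -- of `L` and `k`. Monotonicity of `Ψ` up to `C` then suffices and no doubling
              -- condition enters.
              rcases le_or_gt k L with hkL | hkL
              · refine le_add_right (ENNReal.ofReal_le_ofReal (hΨC _ _ (by positivity) ?_))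
                have : (k : ℝ) ≤ L := by exact_mod_cast hkL
                linarith
              · refine le_add_left ?_
                obtain ⟨i, hi⟩ : ∃ i, k = G i x := hk.resolve_left (fun h => by simp [h] at hkL)
                have : (L : ℝ) < k := by exact_mod_cast hkL
                calc _ ≤ ENNReal.ofReal (C * Ψ (G i x)) := by
                      refine ENNReal.ofReal_le_ofReal (hΨC _ _ (by positivity) ?_)
                      rw [← hi]; linarith
                  _ = ENNReal.ofReal C * ENNReal.ofReal (Ψ (G i x)) := ENNReal.ofReal_mul hC
                  _ ≤ _ := by gcongr; exact ENNReal.le_tsum i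
            · have : u =ᶠ[𝓝 x] fun _ => 0 := by
                filter_upwards [(isClosed_tsupport ζ).isOpen_compl.mem_nhds hxζ] with y hy
                exact huz y hy
              simp [this.fderiv_eq, hΨz]
        _ < ⊤ := by
            have hm : ∀ i, Measurable fun x => ENNReal.ofReal (Ψ (G i x)) := fun i =>
              (hΨm.comp (measurable_coe_nnreal_real.comp (hGm i))).ennreal_ofReal
            rw [lintegral_add_left (measurable_const.indicator (isClosed_tsupport ζ).measurableSet),
              lintegral_indicator_const (isClosed_tsupport ζ).measurableSet,
              lintegral_const_mul _ (Measurable.tsum hm),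
              lintegral_tsum fun i => (hm i).aemeasurable]
            exact ENNReal.add_lt_top.2
              ⟨ENNReal.mul_lt_top ENNReal.ofReal_lt_top hζc.isCompact.measure_lt_top,
                ENNReal.mul_lt_top ENNReal.ofReal_lt_top henergy.lt_top⟩
    · obtain ⟨k, -, V, hV, hkV⟩ := hlip x hx
      exact ⟨_, V, hV, hkV⟩
  intro hrem
  obtain ⟨v, -, hv⟩ := ((hrem u).1 hmemu).2 (Fin.last m)
  refine not_isWeakPartialDeriv_of_jump hum (M := 1)
    (fun x => by rw [abs_of_nonneg (hu01 x).1]; exact (hu01 x).2)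
    (fun x hx => by simp [hu, not_lt.2 hx]) (κ := fun y => η y * (1 - B (hyperplaneEmb (m + 1) y)))
    (η := η) ?_ (fun y => mul_nonneg η.nonneg (by linarith [hB1 (hyperplaneEmb (m + 1) y)]))
    (fun y => mul_le_one₀ η.le_one (by linarith [hB1 (hyperplaneEmb (m + 1) y)])
      (by linarith [hB0 (hyperplaneEmb (m + 1) y)])) ?_ hηd η.hasCompactSupport
    (fun y => η.nonneg) ?_ v hv
  · exact hηd.continuous.measurable.mul
      (measurable_const.sub (hBm.comp continuous_hyperplaneEmb.measurable))
  · intro x hx0 hx1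
    simp only [hu, hx0, if_true, hζ]
    rw [intervalCutoff_eq_one (by rw [one_mul, abs_of_pos hx0]; exact hx1.le), mul_one]
    exact mul_le_mul_of_nonneg_left (by linarith [hBmono x]) η.nonneg
  · have hm : Measurable fun y => 1 - B (hyperplaneEmb (m + 1) y) :=
      measurable_const.sub (hBm.comp continuous_hyperplaneEmb.measurable)
    have hnn : ∀ y : EuclideanSpace ℝ (Fin m), 0 ≤ 1 - B (hyperplaneEmb (m + 1) y) := fun y => by
      linarith [hB1 (hyperplaneEmb (m + 1) y)]
    -- The bump `η` occurs twice in the integrand: once as the test function and once inside `κ`,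
    -- coming from the factor `ζ` of `u`.
    rw [integral_pos_iff_support_of_nonneg
      (fun y => mul_nonneg η.nonneg (mul_nonneg η.nonneg (hnn y)))]
    · have hpos := hx₀pos ((S ∩ U) ∩ ball x₀ r)
        (inter_mem self_mem_nhdsWithin (mem_nhdsWithin_of_mem_nhds (ball_mem_nhds x₀ hr)))
      refine hpos.trans_le (measure_mono_ae ?_)
      filter_upwards [htrace] with y hy hyS
      obtain ⟨c, hc, hyc⟩ := hy hyS.1.1
      have h1 : η y ≠ 0 := by
        have : y ∈ Function.support η := by rw [η.support_eq]; exact hyS.2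
        exact this
      have h2 : B (hyperplaneEmb (m + 1) y) < 1 :=
        (Real.iSup_le (a := max c 0) (fun i => (hyc i).trans (le_max_left _ _))
          (le_max_right _ _)).trans_lt (max_lt hc one_pos)
      exact mul_ne_zero h1 (mul_ne_zero h1 (by linarith))
    · have hηi : Integrable η := η.continuous.integrable_of_hasCompactSupport η.hasCompactSupport
      refine hηi.mul_bdd (c := 1) (hηd.continuous.measurable.mul hm).aestronglyMeasurable
        (Eventually.of_forall fun y => ?_)
      rw [Real.norm_eq_abs, abs_of_nonneg (mul_nonneg η.nonneg (hnn y))]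
      exact mul_le_one₀ η.le_one (hnn y) (by linarith [hB0 (hyperplaneEmb (m + 1) y)])

end Barrier

/-! ### Bumps of one variable and their pointwise Lipschitz bounds -/

section Profile

/-- Pulls a bump back along a norm, a coordinate splitting or the coordinates of a rectangle without
loss in its pointwise Lipschitz bound. -/
theorem exists_lipschitzOnWith_comp {X Y : Type*} [PseudoMetricSpace X] [PseudoMetricSpace Y]
    {f : Y → ℝ} {g : Y → ℝ≥0} (hf : ∀ s, ∃ U ∈ 𝓝 s, LipschitzOnWith (g s) f U) {N : X → Y}
    (hN : LipschitzWith 1 N) (x : X) : ∃ U ∈ 𝓝 x, LipschitzOnWith (g (N x)) (fun x => f (N x)) U := by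
  obtain ⟨U, hU, hL⟩ := hf (N x)
  refine ⟨N ⁻¹' U, hN.continuous.continuousAt hU, ?_⟩
  have h := hL.comp hN.lipschitzOnWith (mapsTo_preimage N U)
  rwa [mul_one] at h

/-- The bump which is `1` for `s ≤ a`, `0` for `s ≥ b`, and `1 - h` in between. -/
noncomputable def radialBump (a b : ℝ) (h : ℝ → ℝ) (s : ℝ) : ℝ := 1 - h (max a (min b s))

open Classical in
/-- A bound for the local Lipschitz constant of `radialBump a b h`, where `h'` is the derivative
of `h`. -/
noncomputable def radialGauge (a b : ℝ) (h' : ℝ → ℝ) (s : ℝ) : ℝ≥0 :=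
  if s ∈ Icc a b then (2 * h' s).toNNReal else 0

variable {a b : ℝ} {h h' : ℝ → ℝ}

theorem radialBump_of_le (hab : a ≤ b) (ha : h a = 0) {s : ℝ} (hs : s ≤ a) :
    radialBump a b h s = 1 := by
  rw [radialBump, min_eq_right (hs.trans hab), max_eq_left hs, ha, sub_zero]

theorem radialBump_of_ge (hab : a ≤ b) (hb : h b = 1) {s : ℝ} (hs : b ≤ s) :
    radialBump a b h s = 0 := by
  rw [radialBump, min_eq_left hs, max_eq_right hab, hb, sub_self]

theorem max_min_mem_Icc (hab : a ≤ b) (s : ℝ) : max a (min b s) ∈ Icc a b :=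
  ⟨le_max_left _ _, max_le hab (min_le_left _ _)⟩

theorem radialBump_antitone (hab : a ≤ b) (hmono : MonotoneOn h (Icc a b)) :
    Antitone (radialBump a b h) := fun s t hst => by
  have := hmono (max_min_mem_Icc hab s) (max_min_mem_Icc hab t)
    (max_le_max le_rfl (min_le_min le_rfl hst))
  simp only [radialBump]
  linarith

theorem radialBump_nonneg (hab : a ≤ b) (hmono : MonotoneOn h (Icc a b)) (hb : h b = 1) (s : ℝ) :
    0 ≤ radialBump a b h s := by
  rw [← radialBump_of_ge hab hb (le_max_right s b)]
  exact radialBump_antitone hab hmono (le_max_left _ _)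

theorem radialBump_le_one (hab : a ≤ b) (hmono : MonotoneOn h (Icc a b)) (ha : h a = 0) (s : ℝ) :
    radialBump a b h s ≤ 1 := by
  rw [← radialBump_of_le hab ha (min_le_right s a)]
  exact radialBump_antitone hab hmono (min_le_left _ _)

/-- Needed for thin rectangles, whose bumps do not vanish on all of the complement of `2Q`. -/
theorem radialBump_lt_one (hab : a ≤ b) (hmono : StrictMonoOn h (Icc a b)) (ha : h a = 0)
    {s : ℝ} (hab' : a < b) (hs : a < s) : radialBump a b h s < 1 := by
  have := hmono (left_mem_Icc.2 hab) (max_min_mem_Icc hab s) (lt_max_of_lt_right (lt_min hab' hs))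
  rw [radialBump]
  linarith

theorem strictMonoOn_of_hasStrictDerivAt_pos
    (hh : ∀ s ∈ Icc a b, HasStrictDerivAt h (h' s) s) (hpos : ∀ s ∈ Icc a b, 0 < h' s) :
    StrictMonoOn h (Icc a b) := by
  refine strictMonoOn_of_deriv_pos (convex_Icc a b)
    (fun s hs => (hh s hs).hasDerivAt.continuousAt.continuousWithinAt) fun s hs => ?_
  rw [(hh s (interior_subset hs)).hasDerivAt.deriv]
  exact hpos s (interior_subset hs)

/-- Clamping to `[a, b]` is `1`-Lipschitz, so the bound for `h` near a point of the interval passes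
to the bump, endpoints included. Strict differentiability gives local Lipschitz constants only above
`|h'|`, hence the factor `2` in the gauge. -/
theorem exists_lipschitzOnWith_radialBump (hab : a ≤ b) (ha : h a = 0) (hb : h b = 1)
    (hh : ∀ s ∈ Icc a b, HasStrictDerivAt h (h' s) s) (hpos : ∀ s ∈ Icc a b, 0 < h' s) (s : ℝ) :
    ∃ U ∈ 𝓝 s, LipschitzOnWith (radialGauge a b h' s) (radialBump a b h) U := by
  by_cases hs : s ∈ Icc a b
  · have hcs : max a (min b s) = s := by rw [min_eq_right hs.2, max_eq_right hs.1]
    have hK : ‖h' s‖₊ < (2 * h' s).toNNReal := by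
      have := hpos s hs
      rw [← NNReal.coe_lt_coe, coe_nnnorm, Real.norm_eq_abs, abs_of_pos this,
        Real.coe_toNNReal _ (by linarith)]
      linarith
    obtain ⟨U, hU, hL⟩ := (hh s hs).hasStrictFDerivAt.exists_lipschitzOnWith_of_nnnorm_lt
      (2 * h' s).toNNReal (by simpa using hK)
    have hc : LipschitzWith 1 fun s : ℝ => max a (min b s) :=
      (LipschitzWith.id.const_min b).const_max a
    refine ⟨(fun s : ℝ => max a (min b s)) ⁻¹' U, hc.continuous.continuousAt (by simpa [hcs]), ?_⟩
    rw [radialGauge, if_pos hs]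
    have h1 := hL.comp hc.lipschitzOnWith (mapsTo_preimage _ U)
    rw [mul_one] at h1
    refine LipschitzOnWith.of_dist_le_mul fun x hx y hy => ?_
    have := h1.dist_le_mul x hx y hy
    rwa [radialBump, radialBump, dist_sub_left]
  · rw [radialGauge, if_neg hs]
    rcases lt_or_ge s a with h1 | h1
    · refine ⟨Iio a, Iio_mem_nhds h1, LipschitzOnWith.of_dist_le_mul fun x hx y hy => ?_⟩
      rw [radialBump_of_le hab ha (le_of_lt hx), radialBump_of_le hab ha (le_of_lt hy)]
      simp
    · have h2 : b < s := by
        by_contra! h2; exact hs ⟨h1, h2⟩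
      refine ⟨Ioi b, Ioi_mem_nhds h2, LipschitzOnWith.of_dist_le_mul fun x hx y hy => ?_⟩
      rw [radialBump_of_ge hab hb (le_of_lt hx), radialBump_of_ge hab hb (le_of_lt hy)]
      simp

theorem measurable_radialGauge (hh : Measurable h') : Measurable (radialGauge a b h') :=
  Measurable.ite measurableSet_Icc (by fun_prop) measurable_const

end Profile

/-! ### Polar coordinates for an arbitrary norm -/

section Polar

/-- Integration in polar coordinates over an annulus, for a radial function whose radial density is
dominated by the derivative of `P`. -/
theorem lintegral_norm_le_of_hasDerivAt {V : Type*} [NormedAddCommGroup V] [NormedSpace ℝ V]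
    [MeasurableSpace V] [BorelSpace V] [FiniteDimensional ℝ V] [Nontrivial V]
    (μ : Measure V) [μ.IsAddHaarMeasure] {D : ℕ} (hD : Module.finrank ℝ V = D + 1)
    {a b : ℝ} (ha : 0 < a) (hab : a ≤ b)
    {φ P P' : ℝ → ℝ} (hφ : ∀ s ∉ Icc a b, φ s = 0)
    (hφP : ∀ s ∈ Icc a b, s ^ D * φ s ≤ P' s) (hP0 : ∀ s ∈ Icc a b, 0 ≤ P' s)
    (hP : ∀ s ∈ Icc a b, HasDerivAt P (P' s) s) (hPc : ContinuousOn P' (Icc a b)) :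
    ∫⁻ z, ENNReal.ofReal (φ ‖z‖) ∂μ ≤
      ENNReal.ofReal ((D + 1) * μ.real (ball 0 1) * (P b - P a)) := by
  -- The majorant `ψ` replaces `φ`, about whose measurability nothing is known; its radial density
  -- is exactly `P'` on the annulus.
  set ψ : ℝ → ℝ := (Icc a b).indicator fun s => P' s / s ^ D with hψ
  have hle : ∀ s, φ s ≤ ψ s := fun s => by
    by_cases hs : s ∈ Icc a b
    · rw [hψ, indicator_of_mem hs, le_div_iff₀ (pow_pos (ha.trans_le hs.1) _), mul_comm]
      exact hφP s hs
    · rw [hψ, indicator_of_notMem hs, hφ s hs]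
  have hψ0 : ∀ s, 0 ≤ ψ s := fun s => indicator_nonneg (fun s hs =>
    div_nonneg (hP0 s hs) (pow_pos (ha.trans_le hs.1) _).le) s
  have hmul : ∀ s, s ^ D • ψ s = (Icc a b).indicator P' s := fun s => by
    by_cases hs : s ∈ Icc a b
    · have := (pow_pos (ha.trans_le hs.1) D).ne'
      rw [hψ, indicator_of_mem hs, indicator_of_mem hs, smul_eq_mul]
      field_simp
    · rw [hψ, indicator_of_notMem hs, indicator_of_notMem hs, smul_zero]
  have hPi : IntegrableOn P' (Icc a b) := hPc.integrableOn_Icc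
  have hint : Integrable (fun z : V => ψ ‖z‖) μ := by
    rw [integrable_fun_norm_addHaar μ, hD, Nat.add_sub_cancel]
    simp only [hmul]
    exact ((integrable_indicator_iff measurableSet_Icc).2 hPi).integrableOn
  calc _ ≤ ∫⁻ z, ENNReal.ofReal (ψ ‖z‖) ∂μ := lintegral_mono fun z =>
        ENNReal.ofReal_le_ofReal (hle _)
    _ = ENNReal.ofReal (∫ z, ψ ‖z‖ ∂μ) :=
        (ofReal_integral_eq_lintegral_ofReal hint (Eventually.of_forall fun z => hψ0 _)).symm
    _ = _ := by
        rw [integral_fun_norm_addHaar μ ψ, hD, Nat.add_sub_cancel]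
        simp only [hmul]
        rw [setIntegral_indicator measurableSet_Icc,
          inter_eq_right.2 (fun s hs => mem_Ioi.2 (ha.trans_le hs.1)), integral_Icc_eq_integral_Ioc,
          ← intervalIntegral.integral_of_le hab, intervalIntegral.integral_eq_sub_of_hasDerivAt
            (f := P) (f' := P')]
        · simp only [nsmul_eq_mul, smul_eq_mul]
          push_cast
          ring_nf
        · rw [uIcc_of_le hab]; exact hP
        · rw [intervalIntegrable_iff_integrableOn_Icc_of_le hab]; exact hPi

end Polar

/-! ### Adapted coordinates, volume and diameter of rectangles -/

namespace OpenRectangle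

variable {m : ℕ}

/-- Coordinates in `ℝ^m × ℝ` adapted to the rectangle `Q`: the coordinates of `x' - c` in the frame
of `Q`, and `t`. -/
noncomputable def coords (Q : OpenRectangle m) (x : EuclideanSpace ℝ (Fin (m + 1))) :
    (Fin m → ℝ) × ℝ :=
  (fun j => inner ℝ (Q.frame j) (horizontal x - Q.center), vertical x)

/-- The frame is orthonormal and the sup norm is at most the Euclidean norm. As the coordinates also
preserve volume, bumps built for the sup norm keep their Lipschitz bounds and energies in Euclidean
space. -/
theorem lipschitzWith_coords (Q : OpenRectangle m) : LipschitzWith 1 Q.coords := by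
  refine LipschitzWith.of_dist_le_mul fun x y => ?_
  rw [NNReal.coe_one, one_mul, Prod.dist_eq, dist_eq_norm x y]
  have hh : horizontal (x - y) = horizontal x - horizontal y := by ext i; simp [horizontal]
  have hv : vertical (x - y) = vertical x - vertical y := by simp [vertical]
  have h := norm_sq_eq_horizontal_vertical (x - y)
  have h1 : ‖horizontal (x - y)‖ ≤ ‖x - y‖ := by
    apply le_of_sq_le_sq _ (norm_nonneg _); nlinarith [sq_nonneg (vertical (x - y))]
  have h2 : |vertical (x - y)| ≤ ‖x - y‖ := by
    apply abs_le_of_sq_le_sq _ (norm_nonneg _); nlinarith [sq_nonneg ‖horizontal (x - y)‖]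
  refine max_le ((dist_pi_le_iff (norm_nonneg _)).2 fun j => ?_) ?_
  · simp only [coords]
    rw [Real.dist_eq, ← inner_sub_right, sub_sub_sub_cancel_right, ← hh]
    refine (abs_real_inner_le_norm _ _).trans ?_
    rwa [Q.frame.norm_eq_one, one_mul]
  · simp only [coords]
    rwa [Real.dist_eq, ← hv]

theorem measurePreserving_coords (Q : OpenRectangle m) :
    MeasurePreserving Q.coords volume (volume.prod volume) := by
  have h1 : MeasurePreserving (fun y : EuclideanSpace ℝ (Fin m) => y - Q.center) volume volume :=
    measurePreserving_sub_right volume Q.center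
  have h2 := (PiLp.volume_preserving_ofLp (Fin m)).comp (Q.frame.measurePreserving_repr.comp h1)
  have h3 := (h2.prod (MeasurePreserving.id (volume : Measure ℝ))).comp
    measurePreserving_horizontal_vertical
  have h4 : Q.coords = Prod.map (WithLp.ofLp ∘ Q.frame.repr ∘
      fun y : EuclideanSpace ℝ (Fin m) => y - Q.center) id ∘ fun x =>
        (horizontal x, vertical x) := by
    funext x
    refine Prod.ext (funext fun j => ?_) rfl
    simp [coords, OrthonormalBasis.repr_apply_apply, inner_sub_right]
  rw [h4]
  exact h3

theorem coords_hyperplaneEmb_horizontal (Q : OpenRectangle m)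
    (x : EuclideanSpace ℝ (Fin (m + 1))) :
    Q.coords (hyperplaneEmb (m + 1) (horizontal x)) = ((Q.coords x).1, 0) := by
  rw [coords, horizontal_hyperplaneEmb, vertical_hyperplaneEmb, coords]

theorem isOpen_toSet (Q : OpenRectangle m) : IsOpen Q.toSet := by
  have : Q.toSet = ⋂ j, {x | |inner ℝ (Q.frame j) (x - Q.center)| < Q.edge j / 2} := by
    ext x; simp [toSet]
  rw [this]
  exact isOpen_iInter_of_finite fun j => isOpen_lt (by fun_prop) continuous_const

theorem convex_toSet (Q : OpenRectangle m) : Convex ℝ Q.toSet := by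
  have : Q.toSet = ⋂ j, (fun x => (innerSL ℝ (Q.frame j)) x) ⁻¹'
      (ball (inner ℝ (Q.frame j) Q.center) (Q.edge j / 2)) := by
    ext x; simp [toSet, inner_sub_right, Real.dist_eq]
  rw [this]
  exact convex_iInter fun j => (convex_ball _ _).is_linear_preimage
    (innerSL ℝ (Q.frame j)).isLinear

theorem ball_subset_toSet (Q : OpenRectangle m) {ρ : ℝ} (h : ∀ j, 2 * ρ ≤ Q.edge j) :
    ball Q.center ρ ⊆ Q.toSet := fun x hx j => by
  have h1 := abs_real_inner_le_norm (Q.frame j) (x - Q.center)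
  rw [Q.frame.norm_eq_one, one_mul] at h1
  rw [mem_ball, dist_eq_norm] at hx
  linarith [h j]

theorem norm_sub_center_le (Q : OpenRectangle m) {l : ℝ} (h : ∀ j, Q.edge j ≤ l)
    {x : EuclideanSpace ℝ (Fin m)} (hx : x ∈ Q.toSet) : ‖x - Q.center‖ ≤ √m * l / 2 := by
  rcases Nat.eq_zero_or_pos m with rfl | hm
  · have : x - Q.center = 0 := Subsingleton.elim _ _
    simp [this]
  have hl : 0 ≤ l := (Q.edge_pos ⟨0, hm⟩).le.trans (h _)
  rw [mul_div_assoc]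
  refine le_of_sq_le_sq ?_ (by positivity)
  rw [← Q.frame.sum_sq_norm_inner_right, mul_pow, Real.sq_sqrt (by positivity)]
  calc _ ≤ ∑ _j : Fin m, (l / 2) ^ 2 := Finset.sum_le_sum fun j _ => by
        have h1 : |inner ℝ (Q.frame j) (x - Q.center)| < Q.edge j / 2 := hx j
        have h2 := h j
        rw [Real.norm_eq_abs]
        gcongr
        linarith
    _ = _ := by simp

theorem isBounded_toSet (Q : OpenRectangle m) : Bornology.IsBounded Q.toSet := by
  refine (isBounded_closedBall (x := Q.center) (r := √m * (∑ j, Q.edge j) / 2)).subset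
    fun x hx => ?_
  rw [mem_closedBall, dist_eq_norm]
  exact Q.norm_sub_center_le (fun j => Finset.single_le_sum (fun j _ => (Q.edge_pos j).le)
    (Finset.mem_univ j)) hx

theorem diam_le (Q : OpenRectangle m) {l : ℝ} (hl : 0 ≤ l) (h : ∀ j, Q.edge j ≤ l) :
    Q.diam ≤ √m * l := by
  refine diam_le_of_forall_dist_le (by positivity) fun x hx y hy => ?_
  have h1 := Q.norm_sub_center_le h hx
  have h2 := Q.norm_sub_center_le h hy
  have := dist_triangle_right x y Q.center
  rw [dist_eq_norm x Q.center, dist_eq_norm y] at this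
  linarith

/-- The segment through the centre along `Q.frame j` gives it; the rectangle is open, so only
lengths below `Q.edge j` are attained and the bound follows in the limit. -/
theorem edge_le_diam (Q : OpenRectangle m) (j : Fin m) : Q.edge j ≤ Q.diam := by
  have hmem : ∀ θ : ℝ, |θ| < Q.edge j / 2 → Q.center + θ • Q.frame j ∈ Q.toSet := fun θ hθ i => by
    rw [add_sub_cancel_left, inner_smul_right, orthonormal_iff_ite.1 Q.frame.orthonormal i j]
    split_ifs with hij
    · rw [mul_one, hij]; exact hθ
    · rw [mul_zero, abs_zero]; linarith [Q.edge_pos i]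
  refine le_of_forall_lt fun c hc => ?_
  rcases le_or_gt c 0 with h0 | h0
  · obtain ⟨c', hc', hc'2⟩ := exists_between (Q.edge_pos j)
    refine h0.trans_lt (hc'.trans_le ?_)
    have h1 := dist_le_diam_of_mem Q.isBounded_toSet (hmem (c' / 2) (by rw [abs_of_pos] <;> linarith))
      (hmem (-(c' / 2)) (by rw [abs_neg, abs_of_pos] <;> linarith))
    rw [dist_add_left, dist_eq_norm, ← sub_smul, norm_smul, Q.frame.norm_eq_one, mul_one,
      Real.norm_eq_abs, sub_neg_eq_add, add_halves, abs_of_pos hc'] at h1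
    exact h1
  · obtain ⟨c', hc', hc'2⟩ := exists_between hc
    refine hc'.trans_le ?_
    have h1 := dist_le_diam_of_mem Q.isBounded_toSet (hmem (c' / 2) (by rw [abs_of_pos] <;> linarith))
      (hmem (-(c' / 2)) (by rw [abs_neg, abs_of_pos] <;> linarith))
    rw [dist_add_left, dist_eq_norm, ← sub_smul, norm_smul, Q.frame.norm_eq_one, mul_one,
      Real.norm_eq_abs, sub_neg_eq_add, add_halves, abs_of_pos (h0.trans hc')] at h1
    exact h1

end OpenRectangle

/-! ### From bumps around rectangles to non-removability -/

section Holes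

variable {m : ℕ}

/-- `w` is a bump on `ℝ^m × ℝ` equal to `1` near the rectangle centred at `0` with the given edges,
with pointwise Lipschitz bound `g`, vanishing at height `ρ` and with `Ψ`-energy at most `A`. -/
structure IsHoleBump (Ψ : ℝ → ℝ) (edge : Fin m → ℝ) (w : (Fin m → ℝ) × ℝ → ℝ)
    (g : (Fin m → ℝ) × ℝ → ℝ≥0) (ρ A : ℝ) : Prop where
  nonneg : ∀ z, 0 ≤ w z
  le_one : ∀ z, w z ≤ 1
  lipschitz : ∀ z, ∃ U ∈ 𝓝 z, LipschitzOnWith (g z) w U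
  eq_one : ∀ y, (∀ j, |y j| < edge j / 2) → ∀ᶠ z in 𝓝 (y, 0), w z = 1
  le_base : ∀ z, w z ≤ w (z.1, 0)
  eq_zero : ∀ z, ρ ≤ |z.2| → w z = 0
  measurable : Measurable g
  energy : ∫⁻ z, ENNReal.ofReal (Ψ (g z)) ≤ ENNReal.ofReal A

/-- Each such rectangle contains a ball of radius `ε / 2`, and the disjoint rectangles have finite
total volume because they fill part of the unit cube. -/
theorem finite_setOf_forall_le_edge {ι : Type*} {Q : ι → OpenRectangle m}
    (hdisj : Pairwise fun i j => Disjoint (Q i).toSet (Q j).toSet)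
    {E : Set (EuclideanSpace ℝ (Fin m))} (hcompl : openUnitCube m \ E = ⋃ i, (Q i).toSet)
    {ε : ℝ} (hε : 0 < ε) : {i | ∀ j, ε ≤ (Q i).edge j}.Finite := by
  have hfin : volume (⋃ i, (Q i).toSet) ≠ ⊤ := by
    rw [← hcompl]
    refine ((measure_mono (t := closedBall 0 (√m)) fun x hx => ?_).trans_lt
      measure_closedBall_lt_top).ne
    rw [mem_closedBall_zero_iff, EuclideanSpace.norm_eq]
    refine Real.sqrt_le_sqrt ?_
    calc _ ≤ ∑ _j : Fin m, (1 : ℝ) := Finset.sum_le_sum fun j _ => by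
          have := hx.1 j
          rw [Real.norm_eq_abs, abs_of_pos this.1]
          nlinarith [this.1, this.2]
      _ = m := by simp
  refine (Measure.finite_const_le_meas_of_disjoint_iUnion volume
    (measure_ball_pos volume (0 : EuclideanSpace ℝ (Fin m)) (half_pos hε))
    (fun i => (Q i).isOpen_toSet.measurableSet) hdisj hfin).subset fun i hi => ?_
  rw [mem_ofPred_eq] at hi ⊢
  rw [← Measure.addHaar_ball_center volume (Q i).center]
  exact measure_mono ((Q i).ball_subset_toSet fun j => by linarith [hi j])

/-- Transports the bumps to `ℝⁿ` by the coordinates of each rectangle, replaces the finitely many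
bad ones by zero, and applies the barrier criterion. The two conditions on `S` combine: finitely
many nonzero values, each below `1`, have a common bound below `1`. -/
theorem not_isPLRemovable_of_isHoleBump {p lam : ℝ} (hp : 0 < p)
    {E : Set (EuclideanSpace ℝ (Fin m))} (hE : IsCompact E) {ι : Type*} [Countable ι]
    {Q : ι → OpenRectangle m} (hcompl : openUnitCube m \ E = ⋃ i, (Q i).toSet)
    {w : ι → (Fin m → ℝ) × ℝ → ℝ} {g : ι → (Fin m → ℝ) × ℝ → ℝ≥0} {ρ A : ι → ℝ}
    (hbump : ∀ᶠ i in cofinite,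
      IsHoleBump (orliczPsi p lam) (Q i).edge (w i) (g i) (ρ i) (A i))
    (hρ : Tendsto ρ cofinite (𝓝 0)) (hA : Summable A)
    {S : Set (EuclideanSpace ℝ (Fin m))} (hSE : S ⊆ E ∩ openUnitCube m) (hS : volume S ≠ 0)
    (hlt : ∀ᶠ i in cofinite, ∀ y ∈ S, w i ((Q i).coords (hyperplaneEmb (m + 1) y)) < 1)
    (hzero : ∀ᵐ y, y ∈ S → ∀ᶠ i in cofinite, w i ((Q i).coords (hyperplaneEmb (m + 1) y)) = 0) :
    ¬ IsPLRemovable (m + 1) p lam E := by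
  classical
  obtain ⟨C, hC, hΨC⟩ := exists_orliczPsi_le_mul hp lam
  set F : Set ι := {i | ¬ (IsHoleBump (orliczPsi p lam) (Q i).edge (w i) (g i) (ρ i) (A i) ∧
    ∀ y ∈ S, w i ((Q i).coords (hyperplaneEmb (m + 1) y)) < 1)} with hFdef
  have hF : F.Finite := hbump.and hlt
  have hFb : ∀ i ∉ F, IsHoleBump (orliczPsi p lam) (Q i).edge (w i) (g i) (ρ i) (A i) :=
    fun i hi => (not_not.1 hi).1
  have hFlt : ∀ i ∉ F, ∀ y ∈ S, w i ((Q i).coords (hyperplaneEmb (m + 1) y)) < 1 :=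
    fun i hi => (not_not.1 hi).2
  have hgm : ∀ i, Measurable fun x : EuclideanSpace ℝ (Fin (m + 1)) =>
      if i ∈ F then (0 : ℝ≥0) else g i ((Q i).coords x) := fun i => by
    by_cases hi : i ∈ F
    · simp [hi]
    · simp only [hi, if_false]
      exact (hFb i hi).measurable.comp (Q i).lipschitzWith_coords.continuous.measurable
  refine not_isOrliczSobolevRemovable_of_barrier (orliczPsi_zero hp.ne' lam)
    (measurable_orliczPsi p lam) hC hΨC hE hcompl (fun i => (Q i).isOpen_toSet)
    (fun i => (Q i).convex_toSet.addHaar_frontier volume) hF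
    (b := fun i x => if i ∈ F then 0 else w i ((Q i).coords x))
    (G := fun i x => if i ∈ F then 0 else g i ((Q i).coords x)) (ρ := ρ)
    ?_ ?_ ?_ ?_ ?_ ?_ ?_ hgm ?_ hSE hS ?_
  · intro i x
    split_ifs with hi
    exacts [le_rfl, (hFb i hi).nonneg _]
  · intro i x
    split_ifs with hi
    exacts [zero_le_one, (hFb i hi).le_one _]
  · intro i x
    by_cases hi : i ∈ F
    · exact ⟨univ, univ_mem, by simp [hi]⟩
    · simpa [hi] using exists_lipschitzOnWith_comp (hFb i hi).lipschitz (Q i).lipschitzWith_coords x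
  · intro i hi q hq
    simp only [hi, if_false]
    have h := (hFb i hi).eq_one (fun j => inner ℝ ((Q i).frame j) (q - (Q i).center)) hq
    refine (Q i).lipschitzWith_coords.continuous.continuousAt.eventually (p := fun z => w i z = 1) ?_
    rwa [OpenRectangle.coords, horizontal_hyperplaneEmb, vertical_hyperplaneEmb]
  · intro i x
    split_ifs with hi
    · rfl
    · rw [OpenRectangle.coords_hyperplaneEmb_horizontal]
      exact (hFb i hi).le_base _
  · intro i x hx
    split_ifs with hi
    · rfl
    · exact (hFb i hi).eq_zero _ hx
  · intro ε hε
    have := hρ.eventually (gt_mem_nhds hε)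
    simpa [eventually_cofinite] using this
  · refine ne_top_of_le_ne_top hA.tsum_ofReal_ne_top (ENNReal.tsum_le_tsum fun i => ?_)
    by_cases hi : i ∈ F
    · simp [hi, orliczPsi_zero hp.ne']
    · simp only [hi, if_false]
      have hm : Measurable fun z => ENNReal.ofReal (orliczPsi p lam (g i z)) :=
        ((measurable_orliczPsi p lam).comp
          (measurable_coe_nnreal_real.comp (hFb i hi).measurable)).ennreal_ofReal
      rw [(Q i).measurePreserving_coords.lintegral_comp hm]
      exact (hFb i hi).energy
  · filter_upwards [hzero] with y hy hyS
    have hfin : {i | i ∉ F ∧ w i ((Q i).coords (hyperplaneEmb (m + 1) y)) ≠ 0}.Finite :=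
      (show Set.Finite {i | ¬ _} from hy hyS).subset fun i hi => hi.2
    -- Every `c < 1` close enough to `1` bounds the finitely many nonzero values and is positive, so
    -- it bounds the zero values too.
    have hev : ∀ᶠ c in 𝓝[<] (1 : ℝ), ∀ i ∈ {i | i ∉ F ∧
        w i ((Q i).coords (hyperplaneEmb (m + 1) y)) ≠ 0},
        w i ((Q i).coords (hyperplaneEmb (m + 1) y)) ≤ c := by
      rw [eventually_all_finite hfin]
      intro i hi
      exact Eventually.mono (mem_nhdsWithin_of_mem_nhds (lt_mem_nhds (hFlt i hi.1 y hyS)))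
        fun c hc => le_of_lt hc
    obtain ⟨c, ⟨hc, hc0⟩, hc1⟩ := ((hev.and (mem_nhdsWithin_of_mem_nhds
      (lt_mem_nhds zero_lt_one))).and self_mem_nhdsWithin).exists
    refine ⟨c, hc1, fun i => ?_⟩
    split_ifs with hi
    · exact le_of_lt hc0
    · by_cases hw : w i ((Q i).coords (hyperplaneEmb (m + 1) y)) = 0
      · rw [hw]; exact le_of_lt hc0
      · exact hc i ⟨hi, hw⟩

end Holes

/-! ### Energy of radial bumps and the logarithmic profile -/

section RadialEnergy

/-- Energy of a radial bump: the bound `s ^ D * Ψ (2 h'(s)) ≤ A * h'(s)` on the radial density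
gives a bound for the energy by a multiple of `A`. -/
theorem lintegral_radialGauge_le {V : Type*} [NormedAddCommGroup V] [NormedSpace ℝ V]
    [MeasurableSpace V] [BorelSpace V] [FiniteDimensional ℝ V] [Nontrivial V]
    (μ : Measure V) [μ.IsAddHaarMeasure] {D : ℕ} (hD : Module.finrank ℝ V = D + 1)
    {Ψ : ℝ → ℝ} (hΨz : Ψ 0 = 0) {a b A : ℝ} {h h' : ℝ → ℝ} (ha : 0 < a) (hab : a ≤ b) (hA : 0 ≤ A)
    (h0 : h a = 0) (h1 : h b = 1) (hh : ∀ s ∈ Icc a b, HasStrictDerivAt h (h' s) s)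
    (hpos : ∀ s ∈ Icc a b, 0 < h' s) (hc : ContinuousOn h' (Icc a b))
    (hΨ : ∀ s ∈ Icc a b, s ^ D * Ψ (2 * h' s) ≤ A * h' s) :
    ∫⁻ z, ENNReal.ofReal (Ψ (radialGauge a b h' ‖z‖)) ∂μ ≤
      ENNReal.ofReal ((D + 1) * μ.real (ball 0 1) * A) := by
  have key := lintegral_norm_le_of_hasDerivAt μ hD ha hab
    (φ := fun s => Ψ (radialGauge a b h' s)) (P := fun s => A * h s) (P' := fun s => A * h' s)
    (fun s hs => by simp only [radialGauge, if_neg hs, NNReal.coe_zero, hΨz])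
    (fun s hs => by
      simp only [radialGauge, if_pos hs]
      rw [Real.coe_toNNReal _ (by linarith [hpos s hs])]
      exact hΨ s hs)
    (fun s hs => mul_nonneg hA (hpos s hs).le)
    (fun s hs => (hh s hs).hasDerivAt.const_mul A) (continuousOn_const.mul hc)
  simpa [h0, h1] using key

/-- The sign of `lam` decides which of the two bounds on `x` controls `x ^ lam`, so logarithms are
always estimated from both sides. -/
theorem rpow_le_max_mul_rpow {c C L x : ℝ} (hc : 0 < c) (hL : 0 < L) (h1 : c * L ≤ x)
    (h2 : x ≤ C * L) (lam : ℝ) : x ^ lam ≤ max (c ^ lam) (C ^ lam) * L ^ lam := by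
  have hcL := mul_pos hc hL
  have hx : 0 < x := hcL.trans_le h1
  have hC : 0 < C := by
    by_contra! h
    nlinarith
  rcases le_or_gt 0 lam with h | h
  · calc _ ≤ (C * L) ^ lam := Real.rpow_le_rpow hx.le h2 h
      _ = C ^ lam * L ^ lam := Real.mul_rpow hC.le hL.le
      _ ≤ _ := by gcongr; exact le_max_right _ _
  · calc _ ≤ (c * L) ^ lam := Real.rpow_le_rpow_of_nonpos hcL h1 h.le
      _ = c ^ lam * L ^ lam := Real.mul_rpow hc.le hL.le
      _ ≤ _ := by gcongr; exact le_max_left _ _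

/-- The logarithmic profile between the radii `a` and `b`. -/
noncomputable def logProfile (a b s : ℝ) : ℝ := Real.log (s / a) / Real.log (b / a)

theorem log_div_pos {a b : ℝ} (ha : 0 < a) (hab : a < b) : 0 < Real.log (b / a) := Real.log_pos ((one_lt_div ha).2 hab)

theorem hasStrictDerivAt_logProfile {a b : ℝ} (ha : 0 < a) (hab : a < b) {s : ℝ} (hs : s ∈ Icc a b) :
    HasStrictDerivAt (logProfile a b) (1 / (s * Real.log (b / a))) s := by
  have hs0 : s ≠ 0 := (ha.trans_le hs.1).ne'
  have h := ((((hasStrictDerivAt_id s).div_const a).log (div_ne_zero hs0 ha.ne')).div_const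
    (Real.log (b / a)))
  have ha' := ha.ne'
  have h2 := (log_div_pos ha hab).ne'
  refine h.congr_deriv ?_
  simp only [id]
  field_simp

theorem logProfile_deriv_pos {a b : ℝ} (ha : 0 < a) (hab : a < b) {s : ℝ} (hs : s ∈ Icc a b) : 0 < 1 / (s * Real.log (b / a)) :=
  one_div_pos.2 (mul_pos (ha.trans_le hs.1) (log_div_pos ha hab))

theorem continuousOn_logProfile_deriv {a b : ℝ} (ha : 0 < a) (hab : a < b) :
    ContinuousOn (fun s => 1 / (s * Real.log (b / a))) (Icc a b) :=
  continuousOn_const.div (by fun_prop) fun s hs =>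
    (mul_pos (ha.trans_le hs.1) (log_div_pos ha hab)).ne'

theorem logProfile_right {a b : ℝ} (ha : 0 < a) (hab : a < b) : logProfile a b b = 1 := div_self (log_div_pos ha hab).ne'

theorem logProfile_left {a b : ℝ} (ha : 0 < a) : logProfile a b a = 0 := by simp [logProfile, ha.ne']

/-- Energy of the logarithmic bump in the critical case `p = D + 1`, the dimension. -/
theorem exists_lintegral_logProfile_le {V : Type*} [NormedAddCommGroup V] [NormedSpace ℝ V]
    [MeasurableSpace V] [BorelSpace V] [FiniteDimensional ℝ V] [Nontrivial V]
    (μ : Measure V) [μ.IsAddHaarMeasure] {D : ℕ} (hD : Module.finrank ℝ V = D + 1) (lam : ℝ)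
    {c C : ℝ} (hc : 0 < c) :
    ∃ K, 0 ≤ K ∧ ∀ a b L : ℝ, 0 < a → a < b → 0 < L → c * L ≤ Real.log (b / a) →
      (∀ s ∈ Icc a b, c * L ≤ Real.log (Real.exp 1 + 2 / (s * Real.log (b / a))) ∧
        Real.log (Real.exp 1 + 2 / (s * Real.log (b / a))) ≤ C * L) →
      ∫⁻ z, ENNReal.ofReal (orliczPsi (D + 1) lam
        (radialGauge a b (fun s => 1 / (s * Real.log (b / a))) ‖z‖)) ∂μ ≤
      ENNReal.ofReal (K * L ^ (lam - D)) := by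
  set M := max (c ^ lam) (C ^ lam) with hM
  have hM0 : 0 < M := lt_max_of_lt_left (by positivity)
  refine ⟨(D + 1) * μ.real (ball 0 1) * (2 ^ (D + 1) * M / c ^ D), by positivity,
    fun a b L ha hab hL hΛ hlog => ?_⟩
  have hΛ0 := log_div_pos ha hab
  set Λ := Real.log (b / a) with hΛdef
  have hLl : 0 < L ^ lam := by positivity
  refine (lintegral_radialGauge_le μ hD (A := 2 ^ (D + 1) * M * L ^ lam / Λ ^ D)
    (orliczPsi_zero (by positivity) lam) ha hab.le (by positivity) (logProfile_left ha)
    (logProfile_right ha hab) (fun s hs => hasStrictDerivAt_logProfile ha hab hs)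
    (fun s hs => logProfile_deriv_pos ha hab hs) (continuousOn_logProfile_deriv ha hab)
    fun s hs => ?_).trans (ENNReal.ofReal_le_ofReal ?_)
  · have hs0 : 0 < s := ha.trans_le hs.1
    have h1 := rpow_le_max_mul_rpow hc hL (hlog s hs).1 (hlog s hs).2 lam
    rw [orliczPsi, mul_one_div, show (D : ℝ) + 1 = ((D + 1 : ℕ) : ℝ) by push_cast; ring,
      Real.rpow_natCast]
    -- Criticality is used here: `s ^ D * (2 / (s * Λ)) ^ (D + 1)` is `2 ^ (D + 1) / Λ ^ D` times
    -- the derivative `1 / (s * Λ)` of the profile.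
    calc _ ≤ s ^ D * ((2 / (s * Λ)) ^ (D + 1) * (M * L ^ lam)) := by gcongr
      _ = _ := by rw [div_pow, mul_pow, ← hΛdef]; field_simp; ring
  · rw [mul_assoc]
    rw [mul_assoc ((D : ℝ) + 1) (μ.real _) (_ / _), mul_assoc ((D : ℝ) + 1), mul_assoc (μ.real _)]
    gcongr
    rw [Real.rpow_sub hL, Real.rpow_natCast]
    calc _ ≤ 2 ^ (D + 1) * M * L ^ lam / (c * L) ^ D := by gcongr
      _ = _ := by rw [mul_pow]; field_simp

end RadialEnergy

/-! ### Radial bumps around a cube -/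

section Cubes

variable {m : ℕ}

/-- In `(Fin m → ℝ) × ℝ` the norm is the sup norm, whose balls are cubes. A rectangle with edges at
most `l` lies in the closed ball of radius `l / 2`, and `l / 2 < a` leaves room for a neighbourhood
on which the bump is `1`. -/
theorem isHoleBump_radial {Ψ : ℝ → ℝ} {edge : Fin m → ℝ} {l a b A : ℝ} {h h' : ℝ → ℝ}
    (hl : 0 ≤ l) (hedge : ∀ j, edge j ≤ l) (hla : l / 2 < a) (hab : a < b) (h0 : h a = 0)
    (h1 : h b = 1) (hh : ∀ s ∈ Icc a b, HasStrictDerivAt h (h' s) s)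
    (hpos : ∀ s ∈ Icc a b, 0 < h' s) (hm : Measurable h')
    (henergy : ∫⁻ z : (Fin m → ℝ) × ℝ, ENNReal.ofReal (Ψ (radialGauge a b h' ‖z‖)) ≤
      ENNReal.ofReal A) :
    IsHoleBump Ψ edge (fun z => radialBump a b h ‖z‖) (fun z => radialGauge a b h' ‖z‖) b A where
  nonneg z := radialBump_nonneg hab.le (strictMonoOn_of_hasStrictDerivAt_pos hh hpos).monotoneOn h1 _
  le_one z := radialBump_le_one hab.le (strictMonoOn_of_hasStrictDerivAt_pos hh hpos).monotoneOn h0 _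
  lipschitz z := exists_lipschitzOnWith_comp
    (exists_lipschitzOnWith_radialBump hab.le h0 h1 hh hpos) lipschitzWith_one_norm z
  eq_one y hy := by
    have hlt : ‖(y, (0 : ℝ))‖ < a := by
      refine lt_of_le_of_lt (norm_prod_le_iff.2 ⟨?_, by simpa using div_nonneg hl zero_le_two⟩) hla
      exact (pi_norm_le_iff_of_nonneg (div_nonneg hl zero_le_two)).2 fun j => by
        rw [Real.norm_eq_abs]; linarith [hy j, hedge j]
    filter_upwards [continuous_norm.continuousAt.eventually (gt_mem_nhds hlt)] with z hz
    exact radialBump_of_le hab.le h0 (le_of_lt hz)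
  le_base z := by
    refine radialBump_antitone hab.le (strictMonoOn_of_hasStrictDerivAt_pos hh hpos).monotoneOn ?_
    exact norm_prod_le_iff.2 ⟨norm_fst_le z, by simp⟩
  eq_zero z hz := radialBump_of_ge hab.le h1 (hz.trans (norm_snd_le z))
  measurable := (measurable_radialGauge hm).comp measurable_norm
  energy := henergy

theorem finrank_pi_prod : Module.finrank ℝ ((Fin m → ℝ) × ℝ) = m + 1 := by simp

/-- A point outside the dilated cube has base coordinates of large norm. -/
theorem OpenRectangle.le_norm_coords {Q : OpenRectangle m} {c β : ℝ}
    (hβ : ∀ j, β ≤ c * Q.edge j / 2) {y : EuclideanSpace ℝ (Fin m)} (hy : y ∉ Q.dilate c) :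
    β ≤ ‖Q.coords (hyperplaneEmb (m + 1) y)‖ := by
  have : ∃ j, c * Q.edge j / 2 ≤ |inner ℝ (Q.frame j) (y - Q.center)| := by
    by_contra! h
    exact hy h
  obtain ⟨j, hj⟩ := this
  refine (hβ j).trans (hj.trans ?_)
  have h1 := (norm_le_pi_norm (Q.coords (hyperplaneEmb (m + 1) y)).1 j).trans (norm_fst_le _)
  rw [Real.norm_eq_abs] at h1
  rwa [OpenRectangle.coords, horizontal_hyperplaneEmb] at h1 ⊢

end Cubes

/-! ### Linear, logarithmic and doubly logarithmic bumps -/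

section CubeBumps

variable {m : ℕ}

instance isAddHaarMeasure_volume_pi_prod :
    (volume : Measure ((Fin m → ℝ) × ℝ)).IsAddHaarMeasure :=
  inferInstanceAs (Measure.prod volume volume).IsAddHaarMeasure

/-- Here `exp (-L)` is the diameter. The slope is `4 / l` on a set of volume about `l ^ (m + 1)`, so
the energy is about `l ^ (m + 1) * Ψ (8 / l)`. The outer radius `l` is the half-edge of `2Q`. -/
theorem exists_isHoleBump_linear (m : ℕ) {p : ℝ} (hp : 0 < p) (hpm : p ≤ m + 1) (lam κ : ℝ) :
    ∃ K L₀ : ℝ, ∀ (edge : Fin m → ℝ) (l L : ℝ), (∀ j, edge j ≤ l) → 0 < l →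
      l ≤ Real.exp (-L) → Real.exp (-L) ≤ κ * l → L₀ ≤ L →
      IsHoleBump (orliczPsi p lam) edge
        (fun z => radialBump (3 * l / 4) l (fun s => (s - 3 * l / 4) * (4 / l)) ‖z‖)
        (fun z => radialGauge (3 * l / 4) l (fun _ => 4 / l) ‖z‖) l
        (K * (Real.exp (-L) ^ ((m : ℝ) + 1 - p) * L ^ lam)) := by
  set v := (volume : Measure ((Fin m → ℝ) × ℝ)).real (ball 0 1)
  set M := max ((1 : ℝ) ^ lam) (2 ^ lam)
  -- The threshold on `L` absorbs `e + 8 * κ` into `exp L`, so that `log (e + 8 / l)` lies between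
  -- `L` and `2 * L`.
  refine ⟨(m + 1) * v * (8 ^ p * M / 4), max 1 (Real.log (Real.exp 1 + 8 * κ)),
    fun edge l L hedge hl hlL hLl hL => ?_⟩
  have hL1 : 1 ≤ L := (le_max_left _ _).trans hL
  have hLκ : Real.log (Real.exp 1 + 8 * κ) ≤ L := (le_max_right _ _).trans hL
  have hκ : 0 < κ := by
    by_contra! h
    nlinarith [Real.exp_pos (-L)]
  have hΨ8 : 0 ≤ orliczPsi p lam (8 / l) := orliczPsi_nonneg _ _ (by positivity)
  have hd : ∀ s, HasStrictDerivAt (fun s => (s - 3 * l / 4) * (4 / l)) (4 / l) s := fun s => by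
    have h : HasStrictDerivAt (fun s => s - 3 * l / 4) 1 s :=
      (hasStrictDerivAt_id s).sub_const (3 * l / 4)
    simpa using HasStrictDerivAt.mul_const h (4 / l)
  refine isHoleBump_radial hl.le hedge (by linarith) (by linarith) (by simp) (by field_simp; ring)
    (fun s _ => hd s) (fun s _ => by positivity) measurable_const ?_
  refine (lintegral_radialGauge_le volume finrank_pi_prod (orliczPsi_zero hp.ne' lam)
    (A := l ^ (m + 1) * orliczPsi p lam (8 / l) / 4) (by positivity) (by linarith) (by positivity)
    (by simp) (by field_simp; ring) (fun s _ => hd s) (fun s _ => by positivity)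
    continuousOn_const fun s hs => ?_).trans (ENNReal.ofReal_le_ofReal ?_)
  · have hs0 : 0 ≤ s := le_trans (by positivity) hs.1
    rw [show (2 : ℝ) * (4 / l) = 8 / l by ring]
    calc _ ≤ l ^ m * orliczPsi p lam (8 / l) := by gcongr; exact hs.2
      _ = _ := by field_simp; ring
  · have hlow : 1 * L ≤ Real.log (Real.exp 1 + 8 / l) := by
      rw [one_mul, Real.le_log_iff_exp_le (by positivity)]
      have h1 : Real.exp L ≤ 1 / l := by
        rw [le_div_iff₀ hl]
        calc _ ≤ Real.exp L * Real.exp (-L) := by gcongr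
          _ = 1 := by rw [← Real.exp_add]; simp
      have h2 : 1 / l ≤ 8 / l := by gcongr; norm_num
      linarith [Real.exp_pos 1]
    have hupp : Real.log (Real.exp 1 + 8 / l) ≤ 2 * L := by
      rw [Real.log_le_iff_le_exp (by positivity)]
      have h1 : 8 / l ≤ 8 * κ * Real.exp L := by
        rw [div_le_iff₀ hl]
        calc (8 : ℝ) = 8 * (Real.exp L * Real.exp (-L)) := by rw [← Real.exp_add]; simp
          _ ≤ 8 * (Real.exp L * (κ * l)) := by gcongr
          _ = _ := by ring
      have h2 : Real.exp 1 ≤ Real.exp 1 * Real.exp L :=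
        le_mul_of_one_le_right (Real.exp_pos 1).le (Real.one_le_exp (by linarith))
      calc _ ≤ (Real.exp 1 + 8 * κ) * Real.exp L := by linarith
        _ ≤ Real.exp L * Real.exp L := by
            gcongr
            rwa [← Real.log_le_iff_le_exp (by positivity)]
        _ = _ := by rw [← Real.exp_add]; ring_nf
    have hlog := rpow_le_max_mul_rpow one_pos (by linarith : 0 < L) hlow hupp lam
    have hpow : l ^ ((m : ℝ) + 1 - p) ≤ Real.exp (-L) ^ ((m : ℝ) + 1 - p) :=
      Real.rpow_le_rpow hl.le hlL (by linarith)
    have hsplit : l ^ (m + 1) * (8 / l) ^ p = 8 ^ p * l ^ ((m : ℝ) + 1 - p) := by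
      rw [Real.div_rpow (by norm_num) hl.le, Real.rpow_sub hl,
        show (m : ℝ) + 1 = ((m + 1 : ℕ) : ℝ) by push_cast; ring, Real.rpow_natCast]
      ring
    have hM : 0 ≤ M := le_max_of_le_left (by positivity)
    calc _ = (m + 1) * v * ((l ^ (m + 1) * (8 / l) ^ p) *
          Real.log (Real.exp 1 + 8 / l) ^ lam / 4) := by rw [orliczPsi]; ring
      _ ≤ (m + 1) * v * ((8 ^ p * Real.exp (-L) ^ ((m : ℝ) + 1 - p)) * (M * L ^ lam) / 4) := by
          rw [hsplit]
          have : 0 ≤ v := measureReal_nonneg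
          gcongr
          exact Real.rpow_nonneg (zero_le_one.trans (one_le_log_exp_one_add (by positivity))) _
      _ = _ := by ring

/-- With `exp (-L)` the diameter `d`, the outer radius `exp (L / 2) * l / 2` is half of `d ^ (-1/2)
* l`, the half-edge of `d ^ (-1/2) Q` for a cube of edge `l`. The ratio of the radii has logarithm
`L / 2 - log 2`, and throughout the annulus the logarithm of the gradient is comparable to `L`. -/
theorem exists_isHoleBump_log (m : ℕ) (lam κ : ℝ) :
    ∃ K L₀ : ℝ, ∀ (edge : Fin m → ℝ) (l L : ℝ), (∀ j, edge j ≤ l) → 0 < l →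
      l ≤ Real.exp (-L) → Real.exp (-L) ≤ κ * l → L₀ ≤ L →
      IsHoleBump (orliczPsi (m + 1) lam) edge
        (fun z => radialBump l (Real.exp (L / 2) * l / 2)
          (logProfile l (Real.exp (L / 2) * l / 2)) ‖z‖)
        (fun z => radialGauge l (Real.exp (L / 2) * l / 2)
          (fun s => 1 / (s * Real.log (Real.exp (L / 2) * l / 2 / l))) ‖z‖)
        (Real.exp (L / 2) * l / 2) (K * L ^ (lam - m)) := by
  obtain ⟨K, -, hK⟩ := exists_lintegral_logProfile_le
    (volume : Measure ((Fin m → ℝ) × ℝ)) finrank_pi_prod lam (c := 1 / 4) (C := 2) (by norm_num)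
  refine ⟨K, max 8 (Real.log (Real.exp 1 + 2 * κ)), fun edge l L hedge hl hlL hLl hL => ?_⟩
  have hL8 : 8 ≤ L := (le_max_left _ _).trans hL
  have hLκ : Real.log (Real.exp 1 + 2 * κ) ≤ L := (le_max_right _ _).trans hL
  have hκ : 0 < κ := by
    by_contra! h
    nlinarith [Real.exp_pos (-L)]
  have hlog2 := Real.log_two_lt_d9
  have hΛ : Real.log (Real.exp (L / 2) * l / 2 / l) = L / 2 - Real.log 2 := by
    rw [show Real.exp (L / 2) * l / 2 / l = Real.exp (L / 2) / 2 by field_simp,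
      Real.log_div (Real.exp_ne_zero _) two_ne_zero, Real.log_exp]
  have hab : l < Real.exp (L / 2) * l / 2 := by
    have := Real.add_one_le_exp (L / 2)
    nlinarith
  refine isHoleBump_radial hl.le hedge (by linarith) hab (logProfile_left hl)
    (logProfile_right hl hab) (fun s hs => hasStrictDerivAt_logProfile hl hab hs)
    (fun s hs => logProfile_deriv_pos hl hab hs) (by fun_prop) ?_
  refine hK _ _ L hl hab (by linarith) (by rw [hΛ]; linarith) fun s hs => ?_
  rw [hΛ]
  have hs0 : 0 < s := hl.trans_le hs.1
  have hlog2' := Real.log_two_gt_d9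
  have hΛ1 : 1 ≤ L / 2 - Real.log 2 := by linarith
  have hΛ2 : L / 2 - Real.log 2 ≤ L / 2 := by linarith
  set Λ := L / 2 - Real.log 2
  constructor
  · rw [Real.le_log_iff_exp_le (by positivity)]
    have h1 : s * Λ ≤ Real.exp (-(1 / 4 * L)) := by
      calc s * Λ ≤ (Real.exp (L / 2) * l / 2) * (L / 2) := by gcongr; exact hs.2
        _ ≤ (Real.exp (L / 2) * Real.exp (-L) / 2) * (L / 2) := by gcongr
        _ = Real.exp (-(L / 2)) * (L / 4) := by rw [← Real.exp_add]; ring_nf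
        _ ≤ Real.exp (-(L / 2)) * Real.exp (L / 4) := by
            gcongr; linarith [Real.add_one_le_exp (L / 4)]
        _ = _ := by rw [← Real.exp_add]; ring_nf
    have h2 : Real.exp (1 / 4 * L) ≤ 2 / (s * Λ) := by
      rw [le_div_iff₀ (by positivity)]
      calc _ ≤ Real.exp (1 / 4 * L) * Real.exp (-(1 / 4 * L)) := by gcongr
        _ = 1 := by rw [← Real.exp_add]; simp
        _ ≤ 2 := by norm_num
    linarith [Real.exp_pos 1]
  · rw [Real.log_le_iff_le_exp (by positivity)]
    have h1 : 2 / (s * Λ) ≤ 2 * κ * Real.exp L := by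
      rw [div_le_iff₀ (by positivity)]
      calc (2 : ℝ) = 2 * (Real.exp L * Real.exp (-L)) := by rw [← Real.exp_add]; simp
        _ ≤ 2 * (Real.exp L * (κ * l)) := by gcongr
        _ = 2 * κ * Real.exp L * (l * 1) := by ring
        _ ≤ _ := by gcongr; exact hs.1
    have h2 : Real.exp 1 ≤ Real.exp 1 * Real.exp L :=
      le_mul_of_one_le_right (Real.exp_pos 1).le (Real.one_le_exp (by linarith))
    calc _ ≤ (Real.exp 1 + 2 * κ) * Real.exp L := by linarith
      _ ≤ Real.exp L * Real.exp L := by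
          gcongr
          rwa [← Real.log_le_iff_le_exp (by positivity)]
      _ = _ := by rw [← Real.exp_add]; ring_nf

/-- The doubly logarithmic profile between the radii `a` and `b`. -/
noncomputable def logLogProfile (a b s : ℝ) : ℝ :=
  (Real.log (-Real.log a) - Real.log (-Real.log s)) /
    (Real.log (-Real.log a) - Real.log (-Real.log b))

/-- With `q = -log s`, the slope `1 / (s * q * Λ)` has logarithm at most about `q`. For `lam = m`
the weight `q ^ m` cancels all but one factor of `1 / q ^ (m + 1)`, and the density is again a
multiple `Λ ^ (-m)` of the slope. Between `exp (-L)` and `exp (-√L)`, `log (-log s)` varies by about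
`log L / 2`. -/
theorem exists_isHoleBump_logLog (m : ℕ) (κ : ℝ) :
    ∃ K L₀ : ℝ, ∀ (edge : Fin m → ℝ) (l L : ℝ), (∀ j, edge j ≤ l) → 0 < l →
      l ≤ Real.exp (-L) → Real.exp (-L) ≤ κ * l → L₀ ≤ L →
      IsHoleBump (orliczPsi (m + 1) m) edge
        (fun z => radialBump l (Real.exp (L - √L) * l / 2)
          (logLogProfile l (Real.exp (L - √L) * l / 2)) ‖z‖)
        (fun z => radialGauge l (Real.exp (L - √L) * l / 2)
          (fun s => 1 / (s * -Real.log s * (Real.log (-Real.log l) -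
            Real.log (-Real.log (Real.exp (L - √L) * l / 2))))) ‖z‖)
        (Real.exp (L - √L) * l / 2) (K * Real.log L ^ (-(m : ℝ))) := by
  set v := (volume : Measure ((Fin m → ℝ) × ℝ)).real (ball 0 1)
  -- `L ≥ 16` gives `Λ ≥ log L / 4 ≥ log 2`, and `log (2 * κ) ≤ √L` gives `-log b ≤ 2 * √L`.
  refine ⟨(m + 1) * v * (2 ^ (2 * m + 1) * 4 ^ m), max 16 ((Real.log (2 * κ)) ^ 2),
    fun edge l L hedge hl hlL hLl hL => ?_⟩
  have hL16 : 16 ≤ L := (le_max_left _ _).trans hL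
  have hκ : 0 < κ := by
    by_contra! h
    nlinarith [Real.exp_pos (-L)]
  have hL0 : 0 < L := by linarith
  have hsL : √L ^ 2 = L := Real.sq_sqrt hL0.le
  have hs4 : 4 ≤ √L := Real.le_sqrt_of_sq_le (by linarith)
  have hLκ : Real.log (2 * κ) ≤ √L := Real.le_sqrt_of_sq_le ((le_max_right _ _).trans hL)
  set b := Real.exp (L - √L) * l / 2 with hb
  have hb0 : 0 < b := by positivity
  have hlogl : Real.log l ≤ -L := by rwa [Real.log_le_iff_le_exp hl]
  have hlogl' : -L ≤ Real.log κ + Real.log l := by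
    rw [← Real.log_mul hκ.ne' hl.ne']
    exact (Real.le_log_iff_exp_le (by positivity)).2 hLl
  have hlogb : Real.log b = L - √L + Real.log l - Real.log 2 := by
    rw [hb, Real.log_div (by positivity) two_ne_zero, Real.log_mul (by positivity) hl.ne',
      Real.log_exp]
  rw [Real.log_mul two_ne_zero hκ.ne'] at hLκ
  have hlog2 := Real.log_two_gt_d9
  have hb1 : √L ≤ -Real.log b := by rw [hlogb]; linarith
  have hb2 : -Real.log b ≤ 2 * √L := by rw [hlogb]; linarith
  have hab : l < b := by
    rw [← Real.log_lt_log_iff hl hb0]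
    nlinarith
  have hΛ : Real.log L / 4 ≤ Real.log (-Real.log l) - Real.log (-Real.log b) := by
    have h1 : Real.log L ≤ Real.log (-Real.log l) := Real.log_le_log hL0 (by linarith)
    have h2 : Real.log (-Real.log b) ≤ Real.log 2 + Real.log L / 2 := by
      rw [← Real.log_sqrt hL0.le, ← Real.log_mul two_ne_zero (by positivity)]
      exact Real.log_le_log (by linarith) hb2
    have h3 : 4 * Real.log 2 ≤ Real.log L := by
      rw [← Real.log_rpow two_pos]
      exact Real.log_le_log (by positivity) (by norm_num; exact hL16)
    linarith
  have hlogL : Real.log 2 ≤ Real.log L / 4 := by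
    have : 4 * Real.log 2 ≤ Real.log L := by
      rw [← Real.log_rpow two_pos]
      exact Real.log_le_log (by positivity) (by norm_num; exact hL16)
    linarith
  set Λ := Real.log (-Real.log l) - Real.log (-Real.log b) with hΛdef
  have hΛ0 : 0 < Λ := by linarith
  have hsl : ∀ s ∈ Icc l b, 0 < s ∧ √L ≤ -Real.log s := fun s hs => by
    have hs0 := hl.trans_le hs.1
    exact ⟨hs0, hb1.trans (neg_le_neg (Real.log_le_log hs0 hs.2))⟩
  have h0 : logLogProfile l b l = 0 := by simp [logLogProfile]
  have h1 : logLogProfile l b b = 1 := div_self hΛ0.ne'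
  have hd : ∀ s ∈ Icc l b,
      HasStrictDerivAt (logLogProfile l b) (1 / (s * -Real.log s * Λ)) s := fun s hs => by
    obtain ⟨hs0, hsL⟩ := hsl s hs
    have hs0' := hs0.ne'
    have hne : -Real.log s ≠ 0 := by linarith
    have h := (((Real.hasStrictDerivAt_log hs0').neg.log hne).const_sub
      (Real.log (-Real.log l))).div_const Λ
    refine h.congr_deriv ?_
    rw [Pi.neg_apply]
    field_simp
  have hpos : ∀ s ∈ Icc l b, 0 < 1 / (s * -Real.log s * Λ) := fun s hs => by
    obtain ⟨hs0, hsL⟩ := hsl s hs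
    exact one_div_pos.2 (mul_pos (mul_pos hs0 (by linarith)) hΛ0)
  refine isHoleBump_radial hl.le hedge (by linarith) hab h0 h1 hd hpos (by fun_prop) ?_
  refine (lintegral_radialGauge_le volume finrank_pi_prod (orliczPsi_zero (by positivity) _)
    (A := 2 ^ (2 * m + 1) / Λ ^ m) hl hab.le (by positivity) h0 h1 hd hpos ?_
    fun s hs => ?_).trans (ENNReal.ofReal_le_ofReal ?_)
  · refine continuousOn_const.div (ContinuousOn.mul (ContinuousOn.mul continuousOn_id
      (Real.continuousOn_log.mono fun s hs => (hsl s hs).1.ne').neg) continuousOn_const)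
      fun s hs => ?_
    obtain ⟨hs0, hsL⟩ := hsl s hs
    exact (mul_pos (mul_pos hs0 (by linarith)) hΛ0).ne'
  · obtain ⟨hs0, hsL⟩ := hsl s hs
    set q := -Real.log s with hq
    have hq0 : 0 < q := by linarith
    have hes : 1 / s = Real.exp q := by rw [hq, Real.exp_neg, Real.exp_log hs0, one_div]
    have hle : 2 * (1 / (s * q * Λ)) ≤ Real.exp q := by
      have h2 : 2 ≤ q * Λ := by nlinarith
      rw [← hes, mul_one_div, div_le_div_iff₀ (by positivity) hs0]
      nlinarith
    have hlog : Real.log (Real.exp 1 + 2 * (1 / (s * q * Λ))) ≤ 2 * q := by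
      rw [Real.log_le_iff_le_exp (by positivity), two_mul q, Real.exp_add]
      have h3 : Real.exp 1 ≤ Real.exp q := Real.exp_le_exp.2 (by linarith)
      have h4 := Real.add_one_le_exp q
      nlinarith
    rw [orliczPsi, show (m : ℝ) + 1 = ((m + 1 : ℕ) : ℝ) by push_cast; ring,
      Real.rpow_natCast, Real.rpow_natCast]
    have hlog0 : 0 ≤ Real.log (Real.exp 1 + 2 * (1 / (s * q * Λ))) :=
      zero_le_one.trans (one_le_log_exp_one_add (by positivity))
    calc _ ≤ s ^ m * ((2 * (1 / (s * q * Λ))) ^ (m + 1) * (2 * q) ^ m) := by gcongr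
      _ = _ := by
        rw [mul_one_div, div_pow, mul_pow, mul_pow, mul_pow]
        field_simp
        ring
  · have hlL0 : 0 < Real.log L := by linarith
    have hv : 0 ≤ v := measureReal_nonneg
    rw [mul_assoc _ (_ * _) (Real.log L ^ _)]
    refine mul_le_mul_of_nonneg_left ?_ (by positivity)
    rw [Real.rpow_neg hlL0.le, Real.rpow_natCast]
    calc _ ≤ (2 : ℝ) ^ (2 * m + 1) / (Real.log L / 4) ^ m := by gcongr
      _ = _ := by rw [div_pow]; field_simp

end CubeBumps

/-! ### Non-removability when the holes are cubes -/

section CubeCases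

variable {m : ℕ} {ι : Type*} {Q : ι → OpenRectangle m} {E : Set (EuclideanSpace ℝ (Fin m))}

/-- The edges of the cubes tend to zero, and their diameters are comparable to the edges. -/
theorem exists_edge_of_isCube (hm : 0 < m)
    (hdisj : Pairwise fun i j => Disjoint (Q i).toSet (Q j).toSet)
    (hcompl : openUnitCube m \ E = ⋃ i, (Q i).toSet) (hcube : ∀ i, (Q i).IsCube) :
    ∃ l : ι → ℝ, (∀ i j, (Q i).edge j = l i) ∧ (∀ i, 0 < l i) ∧ (∀ i, l i ≤ (Q i).diam) ∧
      (∀ i, (Q i).diam ≤ √m * l i) ∧ Tendsto l cofinite (𝓝 0) ∧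
      Tendsto (fun i => Real.log (1 / (Q i).diam)) cofinite atTop := by
  choose l hl using hcube
  have hl0 : ∀ i, 0 < l i := fun i => hl i ⟨0, hm⟩ ▸ (Q i).edge_pos ⟨0, hm⟩
  have h1 : ∀ i, l i ≤ (Q i).diam := fun i => hl i ⟨0, hm⟩ ▸ (Q i).edge_le_diam ⟨0, hm⟩
  have h2 : ∀ i, (Q i).diam ≤ √m * l i := fun i => (Q i).diam_le (hl0 i).le fun j => (hl i j).le
  have hlim : Tendsto l cofinite (𝓝 0) := by
    refine tendsto_order.2 ⟨fun c hc => Eventually.of_forall fun i => hc.trans (hl0 i),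
      fun c hc => ?_⟩
    refine (finite_setOf_forall_le_edge hdisj hcompl hc).subset fun i hi j => ?_
    rw [hl i j]
    exact not_lt.1 hi
  refine ⟨l, hl, hl0, h1, h2, hlim, ?_⟩
  have hd : Tendsto (fun i => (Q i).diam) cofinite (𝓝[>] 0) := by
    refine tendsto_nhdsWithin_iff.2 ⟨?_, Eventually.of_forall fun i => (hl0 i).trans_le (h1 i)⟩
    have h3 := hlim.const_mul √m
    rw [mul_zero] at h3
    exact squeeze_zero (fun i => (hl0 i).le.trans (h1 i)) h2 h3
  simp only [one_div]
  exact Real.tendsto_log_atTop.comp (tendsto_inv_nhdsGT_zero.comp hd)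

theorem exp_neg_log_one_div {d : ℝ} (hd : 0 < d) : Real.exp (-Real.log (1 / d)) = d := by
  rw [one_div, Real.log_inv, neg_neg, Real.exp_log hd]

/-- Non-removability from radial bumps around cubes, with outer radii `b i` and radial functions
`f i`. -/
theorem not_isPLRemovable_of_radial [Countable ι] {p lam : ℝ} (hp : 0 < p) (hE : IsCompact E)
    (hcompl : openUnitCube m \ E = ⋃ i, (Q i).toSet) {f : ι → ℝ → ℝ} {g : ι → ℝ → ℝ≥0} {b A c : ι → ℝ}
    {K : ℝ}
    (hbump : ∀ᶠ i in cofinite, IsHoleBump (orliczPsi p lam) (Q i).edge (fun z => f i ‖z‖)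
      (fun z => g i ‖z‖) (b i) (K * A i))
    (hb : Tendsto b cofinite (𝓝 0)) (hA : Summable A)
    {S : Set (EuclideanSpace ℝ (Fin m))} (hSE : S ⊆ E ∩ openUnitCube m) (hS : volume S ≠ 0)
    (hc : ∀ᶠ i in cofinite, ∀ j, b i ≤ c i * (Q i).edge j / 2)
    (hSc : ∀ i, ∀ y ∈ S, y ∉ (Q i).dilate (c i)) :
    ¬ IsPLRemovable (m + 1) p lam E := by
  have hz : ∀ᶠ i in cofinite, ∀ y ∈ S, f i ‖(Q i).coords (hyperplaneEmb (m + 1) y)‖ = 0 := by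
    filter_upwards [hbump, hc] with i h1 h2 y hy
    have h3 := OpenRectangle.le_norm_coords h2 (hSc i y hy)
    -- A radial bump depends on the norm alone, so its vanishing at height `ρ` can be read off at a
    -- point of the vertical axis with the same norm.
    simpa using h1.eq_zero (0, ‖(Q i).coords (hyperplaneEmb (m + 1) y)‖) (by simpa using h3)
  refine not_isPLRemovable_of_isHoleBump hp hE hcompl hbump hb (hA.mul_left K) hSE hS ?_ ?_
  · filter_upwards [hz] with i hi y hy
    rw [hi y hy]
    exact zero_lt_one
  · refine Eventually.of_forall fun y hy => ?_
    filter_upwards [hz] with i hi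
    exact hi y hy

/-- For factors at least `1` the dilates cover the holes, so what remains of the unit cube lies in
`E`. -/
theorem diff_dilate_subset {c : ι → ℝ} (hcompl : openUnitCube m \ E = ⋃ i, (Q i).toSet)
    (hc : ∀ i, 1 ≤ c i) :
    openUnitCube m \ ⋃ i, (Q i).dilate (c i) ⊆ E ∩ openUnitCube m := fun y hy => by
  refine ⟨by_contra fun hyE => hy.2 ?_, hy.1⟩
  have : y ∈ ⋃ i, (Q i).toSet := hcompl ▸ ⟨hy.1, hyE⟩
  obtain ⟨i, hi⟩ := mem_iUnion.1 this
  refine mem_iUnion.2 ⟨i, fun j => (hi j).trans_le ?_⟩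
  have := le_mul_of_one_le_left ((Q i).edge_pos j).le (hc i)
  linarith

variable [Countable ι]

theorem not_isPLRemovable_subcritical (hm : 0 < m) {p lam : ℝ} (hp : 0 < p) (hpm : p ≤ m + 1)
    (hE : IsCompact E) (hdisj : Pairwise fun i j => Disjoint (Q i).toSet (Q j).toSet)
    (hcompl : openUnitCube m \ E = ⋃ i, (Q i).toSet) (hcube : ∀ i, (Q i).IsCube)
    (hS : volume (openUnitCube m \ ⋃ i, (Q i).dilate 2) ≠ 0)
    (hsum : Summable fun i => (Q i).diam ^ ((m : ℝ) + 1 - p) * Real.log (1 / (Q i).diam) ^ lam) :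
    ¬ IsPLRemovable (m + 1) p lam E := by
  obtain ⟨l, hl, hl0, hld, hdl, hlim, hL⟩ := exists_edge_of_isCube hm hdisj hcompl hcube
  obtain ⟨K, L₀, hK⟩ := exists_isHoleBump_linear m hp hpm lam √m
  refine not_isPLRemovable_of_radial hp hE hcompl (b := l) (c := fun _ => 2) (K := K)
    (f := fun i => radialBump (3 * l i / 4) (l i) (fun s => (s - 3 * l i / 4) * (4 / l i)))
    (g := fun i => radialGauge (3 * l i / 4) (l i) (fun _ => 4 / l i)) ?_ hlim hsum
    (diff_dilate_subset hcompl fun _ => one_le_two) hS ?_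
    fun i y hy h => hy.2 (mem_iUnion.2 ⟨i, h⟩)
  · filter_upwards [hL.eventually_ge_atTop L₀] with i hi
    have hd := exp_neg_log_one_div ((hl0 i).trans_le (hld i))
    have := hK (Q i).edge (l i) (Real.log (1 / (Q i).diam)) (fun j => (hl i j).le) (hl0 i)
      (by rw [hd]; exact hld i) (by rw [hd]; exact hdl i) hi
    rwa [hd] at this
  · refine Eventually.of_forall fun i j => ?_
    rw [hl i j]
    linarith

theorem not_isPLRemovable_critical (hm : 0 < m) {lam : ℝ}
    (hE : IsCompact E) (hdisj : Pairwise fun i j => Disjoint (Q i).toSet (Q j).toSet)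
    (hcompl : openUnitCube m \ E = ⋃ i, (Q i).toSet) (hcube : ∀ i, (Q i).IsCube)
    (hS : volume ((E ∩ openUnitCube m) \ ⋃ i, (Q i).dilate ((Q i).diam ^ (-(1 / 2 : ℝ)))) ≠ 0)
    (hsum : Summable fun i => Real.log (1 / (Q i).diam) ^ (lam - m)) :
    ¬ IsPLRemovable (m + 1) (m + 1) lam E := by
  obtain ⟨l, hl, hl0, hld, hdl, hlim, hL⟩ := exists_edge_of_isCube hm hdisj hcompl hcube
  obtain ⟨K, L₀, hK⟩ := exists_isHoleBump_log m lam √m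
  have hd : ∀ i, Real.exp (-Real.log (1 / (Q i).diam)) = (Q i).diam := fun i =>
    exp_neg_log_one_div ((hl0 i).trans_le (hld i))
  have hc : ∀ i, Real.exp (Real.log (1 / (Q i).diam) / 2) = (Q i).diam ^ (-(1 / 2 : ℝ)) :=
    fun i => by
      conv_rhs => rw [← hd i, ← Real.exp_mul]
      ring_nf
  set b : ι → ℝ := fun i => Real.exp (Real.log (1 / (Q i).diam) / 2) * l i / 2 with hb
  have hbump : ∀ᶠ i in cofinite, IsHoleBump (orliczPsi (m + 1) lam) (Q i).edge
      (fun z => radialBump (l i) (b i) (logProfile (l i) (b i)) ‖z‖)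
      (fun z => radialGauge (l i) (b i) (fun s => 1 / (s * Real.log (b i / l i))) ‖z‖) (b i)
      (K * Real.log (1 / (Q i).diam) ^ (lam - m)) := by
    filter_upwards [hL.eventually_ge_atTop L₀] with i hi
    exact hK (Q i).edge (l i) (Real.log (1 / (Q i).diam)) (fun j => (hl i j).le) (hl0 i)
      (by rw [hd]; exact hld i) (by rw [hd]; exact hdl i) hi
  refine not_isPLRemovable_of_radial (by positivity) hE hcompl (b := b)
    (c := fun i => (Q i).diam ^ (-(1 / 2 : ℝ))) (K := K)
    (f := fun i => radialBump (l i) (b i) (logProfile (l i) (b i))) hbump ?_ hsum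
    sdiff_subset hS ?_ fun i y hy h => hy.2 (mem_iUnion.2 ⟨i, h⟩)
  · have h1 : Tendsto (fun i => Real.exp (-(Real.log (1 / (Q i).diam) / 2))) cofinite (𝓝 0) :=
      Real.tendsto_exp_neg_atTop_nhds_zero.comp (hL.atTop_div_const two_pos)
    refine squeeze_zero (fun i => ?_) (fun i => ?_) h1
    · have := (hl0 i).le
      positivity
    · calc b i ≤ Real.exp (Real.log (1 / (Q i).diam) / 2) * Real.exp (-Real.log (1 / (Q i).diam)) := by
            simp only [hb]
            rw [hd, mul_div_assoc]
            gcongr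
            linarith [hl0 i, hld i]
        _ = _ := by rw [← Real.exp_add]; ring_nf
  · refine Eventually.of_forall fun i j => ?_
    rw [hl i j, ← hc i]

/-- For `d ≥ 1` the square root of the nonpositive logarithm is `0`, so the radius is `1` and the
dilate lies inside the cube; such a term removes nothing from `E`. -/
theorem not_isPLRemovable_doubly_critical (hm : 0 < m)
    (hE : IsCompact E) (hdisj : Pairwise fun i j => Disjoint (Q i).toSet (Q j).toSet)
    (hcompl : openUnitCube m \ E = ⋃ i, (Q i).toSet) (hcube : ∀ i, (Q i).IsCube)
    (hS : volume ((E ∩ openUnitCube m) \ ⋃ i, (Q i).dilate ((Q i).expRadius / (Q i).diam)) ≠ 0)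
    (hsum : Summable fun i => Real.log (Real.log (1 / (Q i).diam)) ^ (-(m : ℝ))) :
    ¬ IsPLRemovable (m + 1) (m + 1) m E := by
  obtain ⟨l, hl, hl0, hld, hdl, hlim, hL⟩ := exists_edge_of_isCube hm hdisj hcompl hcube
  obtain ⟨K, L₀, hK⟩ := exists_isHoleBump_logLog m √m
  have hd : ∀ i, Real.exp (-Real.log (1 / (Q i).diam)) = (Q i).diam := fun i =>
    exp_neg_log_one_div ((hl0 i).trans_le (hld i))
  have hc : ∀ i, Real.exp (Real.log (1 / (Q i).diam) - √(Real.log (1 / (Q i).diam))) =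
      (Q i).expRadius / (Q i).diam := fun i => by
    rw [OpenRectangle.expRadius]
    conv_rhs => rw [← hd i, ← Real.exp_sub]
    rw [hd i]
    ring_nf
  set b : ι → ℝ := fun i =>
    Real.exp (Real.log (1 / (Q i).diam) - √(Real.log (1 / (Q i).diam))) * l i / 2 with hb
  have hbump : ∀ᶠ i in cofinite, IsHoleBump (orliczPsi (m + 1) m) (Q i).edge
      (fun z => radialBump (l i) (b i) (logLogProfile (l i) (b i)) ‖z‖)
      (fun z => radialGauge (l i) (b i) (fun s => 1 / (s * -Real.log s *
        (Real.log (-Real.log (l i)) - Real.log (-Real.log (b i))))) ‖z‖) (b i)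
      (K * Real.log (Real.log (1 / (Q i).diam)) ^ (-(m : ℝ))) := by
    filter_upwards [hL.eventually_ge_atTop L₀] with i hi
    exact hK (Q i).edge (l i) (Real.log (1 / (Q i).diam)) (fun j => (hl i j).le) (hl0 i)
      (by rw [hd]; exact hld i) (by rw [hd]; exact hdl i) hi
  refine not_isPLRemovable_of_radial (by positivity) hE hcompl (b := b)
    (c := fun i => (Q i).expRadius / (Q i).diam) (K := K)
    (f := fun i => radialBump (l i) (b i) (logLogProfile (l i) (b i))) hbump ?_ hsum
    sdiff_subset hS ?_ fun i y hy h => hy.2 (mem_iUnion.2 ⟨i, h⟩)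
  · have h1 : Tendsto (fun i => Real.exp (-√(Real.log (1 / (Q i).diam)))) cofinite (𝓝 0) :=
      Real.tendsto_exp_neg_atTop_nhds_zero.comp (Real.tendsto_sqrt_atTop.comp hL)
    refine squeeze_zero (fun i => ?_) (fun i => ?_) h1
    · have := (hl0 i).le
      positivity
    · calc b i ≤ Real.exp (Real.log (1 / (Q i).diam) - √(Real.log (1 / (Q i).diam))) *
            Real.exp (-Real.log (1 / (Q i).diam)) := by
            simp only [hb]
            rw [hd, mul_div_assoc]
            gcongr
            linarith [hl0 i, hld i]
        _ = _ := by rw [← Real.exp_add]; ring_nf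
  · refine Eventually.of_forall fun i j => ?_
    rw [hl i j, ← hc i]

end CubeCases

/-! ### Product bumps around thin rectangles -/

section Thin

variable {k : ℕ}

/-- Splitting of `ℝ^(k+1) × ℝ` into the coordinate `j₀` and the remaining coordinates. -/
def splitAt (j₀ : Fin (k + 1)) (z : (Fin (k + 1) → ℝ) × ℝ) : ℝ × ((Fin k → ℝ) × ℝ) :=
  (z.1 j₀, (fun j => z.1 (j₀.succAbove j), z.2))

theorem measurePreserving_splitAt (j₀ : Fin (k + 1)) : MeasurePreserving (splitAt j₀) := by
  have h1 := (volume_preserving_piFinSuccAbove (fun _ : Fin (k + 1) => ℝ) j₀).prod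
    (MeasurePreserving.id (volume : Measure ℝ))
  exact (volume_preserving_prodAssoc (α₁ := ℝ) (β₁ := Fin k → ℝ) (γ₁ := ℝ)).comp h1

theorem lipschitzWith_splitAt_fst (j₀ : Fin (k + 1)) :
    LipschitzWith 1 fun z => ‖(splitAt j₀ z).1‖ := by
  have h : LipschitzWith 1 fun z : (Fin (k + 1) → ℝ) × ℝ => z.1 j₀ := by
    have := (LipschitzWith.eval (α := fun _ : Fin (k + 1) => ℝ) j₀).comp
      (LipschitzWith.prod_fst (β := ℝ))
    rwa [one_mul] at this
  have := lipschitzWith_one_norm.comp h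
  rwa [one_mul] at this

theorem lipschitzWith_splitAt_snd (j₀ : Fin (k + 1)) :
    LipschitzWith 1 fun z => ‖(splitAt j₀ z).2‖ := by
  have h : LipschitzWith 1 fun z : (Fin (k + 1) → ℝ) × ℝ => (splitAt j₀ z).2 := by
    refine LipschitzWith.of_dist_le_mul fun x y => ?_
    rw [NNReal.coe_one, one_mul, Prod.dist_eq, Prod.dist_eq]
    refine max_le_max ((dist_pi_le_iff dist_nonneg).2 fun j => ?_) le_rfl
    exact dist_le_pi_dist x.1 y.1 _
  have := lipschitzWith_one_norm.comp h
  rwa [one_mul] at this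

open Classical in
/-- A bump on `{|s| ≤ r, ‖y‖ ≤ b}`: the smaller of two radial bumps. -/
theorem isHoleBump_thin {Ψ : ℝ → ℝ} (hΨz : Ψ 0 = 0) (hΨ0 : ∀ t, 0 ≤ t → 0 ≤ Ψ t)
    (hΨm : Measurable Ψ) {edge : Fin (k + 1) → ℝ} {j₀ : Fin (k + 1)}
    {r a b A B : ℝ} {h h' : ℝ → ℝ} (hr : 0 < r) (hA : 0 ≤ A) (hB : 0 ≤ B)
    (hedge₀ : edge j₀ = r)
    (ha : 0 < a) (hedge : ∀ j ≠ j₀, edge j < 2 * a) (hab : a < b) (h0 : h a = 0)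
    (h1 : h b = 1) (hh : ∀ s ∈ Icc a b, HasStrictDerivAt h (h' s) s)
    (hpos : ∀ s ∈ Icc a b, 0 < h' s) (hm : Measurable h')
    (hΨB : (volume : Measure ((Fin k → ℝ) × ℝ)).real (closedBall 0 b) * Ψ (8 / r) ≤ B)
    (henergy : ∫⁻ z : (Fin k → ℝ) × ℝ, ENNReal.ofReal (Ψ (radialGauge a b h' ‖z‖)) ≤
      ENNReal.ofReal A) :
    IsHoleBump Ψ edge
      (fun z => min (radialBump (3 * r / 4) r (fun s => (s - 3 * r / 4) * (4 / r))
        ‖(splitAt j₀ z).1‖) (radialBump a b h ‖(splitAt j₀ z).2‖))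
      (fun z => if ‖(splitAt j₀ z).1‖ ≤ r ∧ ‖(splitAt j₀ z).2‖ ≤ b then
        max (radialGauge (3 * r / 4) r (fun _ => 4 / r) ‖(splitAt j₀ z).1‖)
          (radialGauge a b h' ‖(splitAt j₀ z).2‖) else 0)
      b (2 * r * (A + B)) := by
  have hr34 : 3 * r / 4 ≤ r := by linarith
  have hd : ∀ s ∈ Icc (3 * r / 4) r,
      HasStrictDerivAt (fun s => (s - 3 * r / 4) * (4 / r)) (4 / r) s := fun s _ => by
    have h : HasStrictDerivAt (fun s => s - 3 * r / 4) 1 s :=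
      (hasStrictDerivAt_id s).sub_const (3 * r / 4)
    simpa using HasStrictDerivAt.mul_const h (4 / r)
  have hd0 : ∀ s ∈ Icc (3 * r / 4) r, 0 < 4 / r := fun s _ => by positivity
  have e0 : (fun s => (s - 3 * r / 4) * (4 / r)) (3 * r / 4) = 0 := by simp
  have e1 : (fun s => (s - 3 * r / 4) * (4 / r)) r = 1 := by
    have := hr.ne'
    field_simp
    ring
  set h₁ : ℝ → ℝ := fun s => (s - 3 * r / 4) * (4 / r)
  have hm1 := (strictMonoOn_of_hasStrictDerivAt_pos hd hd0).monotoneOn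
  have hm2 := (strictMonoOn_of_hasStrictDerivAt_pos hh hpos).monotoneOn
  have hn1 := radialBump_nonneg hr34 hm1 e1
  have hn2 := radialBump_nonneg hab.le hm2 h1
  have hc1 := (lipschitzWith_splitAt_fst j₀).continuous
  have hc2 := (lipschitzWith_splitAt_snd j₀).continuous
  have hg1 := measurable_radialGauge (a := 3 * r / 4) (b := r)
    (measurable_const : Measurable fun _ : ℝ => 4 / r)
  have hg2 := measurable_radialGauge (a := a) (b := b) hm
  refine ⟨fun z => le_min (hn1 _) (hn2 _), fun z => (min_le_left _ _).trans
    (radialBump_le_one hr34 hm1 e0 _), fun z => ?_, fun y hy => ?_, fun z => ?_, fun z hz => ?_,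
    ?_, ?_⟩
  · have hzero : ∀ V ∈ 𝓝 z, (∀ x ∈ V, min (radialBump (3 * r / 4) r h₁ ‖(splitAt j₀ x).1‖)
        (radialBump a b h ‖(splitAt j₀ x).2‖) = 0) → ∃ U ∈ 𝓝 z, LipschitzOnWith 0 (fun z =>
        min (radialBump (3 * r / 4) r h₁ ‖(splitAt j₀ z).1‖)
        (radialBump a b h ‖(splitAt j₀ z).2‖)) U := fun V hV hz =>
      ⟨V, hV, LipschitzOnWith.of_dist_le_mul fun x hx y hy => by
        rw [hz x hx, hz y hy]; simp⟩
    by_cases hz : ‖(splitAt j₀ z).1‖ ≤ r ∧ ‖(splitAt j₀ z).2‖ ≤ b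
    · simp only [if_pos hz]
      obtain ⟨U, hU, hUL⟩ := exists_lipschitzOnWith_comp
        (exists_lipschitzOnWith_radialBump hr34 e0 e1 hd hd0) (lipschitzWith_splitAt_fst j₀) z
      obtain ⟨V, hV, hVL⟩ := exists_lipschitzOnWith_comp
        (exists_lipschitzOnWith_radialBump hab.le h0 h1 hh hpos) (lipschitzWith_splitAt_snd j₀) z
      refine ⟨U ∩ V, inter_mem hU hV, LipschitzOnWith.of_dist_le_mul fun x hx y hy => ?_⟩
      rw [Real.dist_eq]
      refine (abs_min_sub_min_le_max _ _ _ _).trans (max_le ?_ ?_)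
      · refine (hUL.dist_le_mul x hx.1 y hy.1).trans ?_
        gcongr
        exact le_max_left _ _
      · refine (hVL.dist_le_mul x hx.2 y hy.2).trans ?_
        gcongr
        exact le_max_right _ _
    -- Off the closed box one of the two bumps vanishes in a neighbourhood, hence so does the
    -- minimum, and the gauge may be `0` there.
    · simp only [if_neg hz]
      rcases not_and_or.1 hz with hz | hz
      · refine hzero _ (hc1.continuousAt.eventually (lt_mem_nhds (not_le.1 hz))) fun x hx => ?_
        rw [radialBump_of_ge hr34 e1 (le_of_lt hx), min_eq_left (hn2 _)]
      · refine hzero _ (hc2.continuousAt.eventually (lt_mem_nhds (not_le.1 hz))) fun x hx => ?_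
        rw [radialBump_of_ge hab.le h1 (le_of_lt hx), min_eq_right (hn1 _)]
  · have i1 : ‖(splitAt j₀ (y, (0 : ℝ))).1‖ < 3 * r / 4 := by
      have := hy j₀
      rw [hedge₀] at this
      simp only [splitAt, Real.norm_eq_abs]
      linarith
    have i2 : ‖(splitAt j₀ (y, (0 : ℝ))).2‖ < a := by
      simp only [splitAt]
      rw [Prod.norm_def]
      refine max_lt ((pi_norm_lt_iff ha).2 fun j => ?_) (by simpa using ha)
      have h2 := hy (j₀.succAbove j)
      have h3 := hedge _ (j₀.succAbove_ne j)
      rw [Real.norm_eq_abs]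
      linarith
    filter_upwards [hc1.continuousAt.eventually (gt_mem_nhds i1),
      hc2.continuousAt.eventually (gt_mem_nhds i2)] with z hz1 hz2
    rw [radialBump_of_le hr34 e0 (le_of_lt hz1), radialBump_of_le hab.le h0 (le_of_lt hz2), min_self]
  · refine min_le_min (radialBump_antitone hr34 hm1 le_rfl) (radialBump_antitone hab.le hm2 ?_)
    simp only [splitAt]
    rw [Prod.norm_def, Prod.norm_def]
    exact max_le_max le_rfl (by simp)
  · have : b ≤ ‖(splitAt j₀ z).2‖ := hz.trans (norm_snd_le (splitAt j₀ z).2)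
    rw [radialBump_of_ge hab.le h1 this, min_eq_right (hn1 _)]
  · exact Measurable.ite ((isClosed_le hc1 continuous_const).inter
      (isClosed_le hc2 continuous_const)).measurableSet
      ((hg1.comp hc1.measurable).max (hg2.comp hc2.measurable)) measurable_const
  -- `Ψ` of the larger gauge is at most a sum of two terms: `Ψ (8 / r)` on the whole box, and the
  -- energy density of the slice over an interval of length `2 * r`.
  · set Φ : ℝ × ((Fin k → ℝ) × ℝ) → ℝ≥0∞ := fun q =>
      (closedBall (0 : ℝ) r ×ˢ closedBall (0 : (Fin k → ℝ) × ℝ) b).indicator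
        (fun _ => ENNReal.ofReal (Ψ (8 / r))) q +
      (closedBall (0 : ℝ) r).indicator (fun _ => (1 : ℝ≥0∞)) q.1 *
        ENNReal.ofReal (Ψ (radialGauge a b h' ‖q.2‖)) with hΦ
    have hms : MeasurableSet (closedBall (0 : ℝ) r ×ˢ closedBall (0 : (Fin k → ℝ) × ℝ) b) :=
      measurableSet_closedBall.prod measurableSet_closedBall
    have hmΨ : Measurable fun y : (Fin k → ℝ) × ℝ => ENNReal.ofReal (Ψ (radialGauge a b h' ‖y‖)) :=
      (hΨm.comp (measurable_coe_nnreal_real.comp (hg2.comp measurable_norm))).ennreal_ofReal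
    have hm1 : Measurable ((closedBall (0 : ℝ) r).indicator (fun _ => (1 : ℝ≥0∞))) :=
      measurable_const.indicator measurableSet_closedBall
    have hΦm : Measurable Φ := (measurable_const.indicator hms).add
      ((hm1.comp measurable_fst).mul (hmΨ.comp measurable_snd))
    calc _ ≤ ∫⁻ z, Φ (splitAt j₀ z) := by
          refine lintegral_mono fun z => ?_
          by_cases hz : ‖(splitAt j₀ z).1‖ ≤ r ∧ ‖(splitAt j₀ z).2‖ ≤ b
          · simp only [if_pos hz, hΦ]
            rw [indicator_of_mem (by simpa using hz), indicator_of_mem (by simpa using hz.1), one_mul]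
            rcases max_choice (radialGauge (3 * r / 4) r (fun _ => 4 / r) ‖(splitAt j₀ z).1‖)
              (radialGauge a b h' ‖(splitAt j₀ z).2‖) with hmax | hmax
            · rw [hmax]
              refine le_add_right (ENNReal.ofReal_le_ofReal ?_)
              rw [radialGauge]
              split_ifs
              · rw [Real.coe_toNNReal _ (by positivity), show 2 * (4 / r) = 8 / r by ring]
              · rw [NNReal.coe_zero, hΨz]
                exact hΨ0 _ (by positivity)
            · rw [hmax]
              exact le_add_left le_rfl
          · simp only [if_neg hz, NNReal.coe_zero, hΨz, ENNReal.ofReal_zero, zero_le]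
      _ = ∫⁻ q, Φ q := (measurePreserving_splitAt j₀).lintegral_comp hΦm
      _ = ENNReal.ofReal (2 * r) * (volume (closedBall (0 : (Fin k → ℝ) × ℝ) b) *
            ENNReal.ofReal (Ψ (8 / r)) +
            ∫⁻ y : (Fin k → ℝ) × ℝ, ENNReal.ofReal (Ψ (radialGauge a b h' ‖y‖))) := by
          rw [hΦ, lintegral_add_left (measurable_const.indicator hms), lintegral_indicator_const hms,
            Measure.volume_eq_prod ℝ, Measure.prod_prod, lintegral_prod_mul hm1.aemeasurable
              hmΨ.aemeasurable, lintegral_indicator_const measurableSet_closedBall,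
            Real.volume_closedBall]
          ring
      _ ≤ ENNReal.ofReal (2 * r) * (ENNReal.ofReal B + ENNReal.ofReal A) := by
          gcongr
          refine le_trans (le_of_eq ?_) (ENNReal.ofReal_le_ofReal hΨB)
          rw [ENNReal.ofReal_mul measureReal_nonneg, measureReal_def,
            ENNReal.ofReal_toReal measure_closedBall_lt_top.ne]
      _ = _ := by
          rw [← ENNReal.ofReal_add hB hA, ← ENNReal.ofReal_mul (by positivity), add_comm]

end Thin

/-! ### Choice of radii and energy for thin rectangles -/

section ThinCase

variable {k : ℕ}

/-- The bump of a thin rectangle whose long edge, of length `r`, is in direction `j₀`. -/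
noncomputable def thinBump (j₀ : Fin (k + 1)) (r a b : ℝ) (z : (Fin (k + 1) → ℝ) × ℝ) : ℝ :=
  min (radialBump (3 * r / 4) r (fun s => (s - 3 * r / 4) * (4 / r)) ‖(splitAt j₀ z).1‖)
    (radialBump a b (logProfile a b) ‖(splitAt j₀ z).2‖)

/-- The slices have dimension `k + 1 = p`, so the logarithmic bump costs `L ^ (lam - k)` per unit
length. The radius `a` lies between the short half-edges of `Q` and `2Q`. The radius `b = r ^ (3 /
2)` is far above `a`, making `log (b / a)` comparable to `L`, and far below `r`, making the linear
part negligible. -/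
theorem exists_isHoleBump_thin (k : ℕ) {lam : ℝ} (hlam : k < lam) :
    ∃ K L₀ : ℝ, 0 ≤ K ∧ ∀ (edge : Fin (k + 1) → ℝ) (j₀ : Fin (k + 1)) (r L : ℝ), edge j₀ = r →
      (∀ j ≠ j₀, edge j = √2 * r ^ 2) → r = Real.exp (-L) → L₀ ≤ L →
      3 * √2 * r ^ 2 / 4 < Real.exp (-(3 / 2 * L)) ∧
      ∃ g, IsHoleBump (orliczPsi (k + 1) lam) edge
        (thinBump j₀ r (3 * √2 * r ^ 2 / 4) (Real.exp (-(3 / 2 * L)))) g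
        (Real.exp (-(3 / 2 * L))) (K * (r * L ^ (lam - k))) := by
  have hlam0 : 0 ≤ lam := (Nat.cast_nonneg k).trans hlam.le
  have hp0 : (0 : ℝ) < k + 1 := by positivity
  obtain ⟨K, hK0, hK⟩ := exists_lintegral_logProfile_le
    (volume : Measure ((Fin k → ℝ) × ℝ)) finrank_pi_prod lam (c := 1 / 4) (C := 3) (by norm_num)
  set v := (volume : Measure ((Fin k → ℝ) × ℝ)).real (ball 0 1)
  set B := v * (8 ^ (k + 1) * 2 ^ lam) * (2 ^ k * k.factorial) with hBdef
  have hB : 0 ≤ B := by positivity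
  refine ⟨2 * (K + B), 8, by positivity, fun edge j₀ r L he₀ he hr hL => ?_⟩
  have hr0 : 0 < r := hr ▸ Real.exp_pos _
  have hL0 : 0 < L := by linarith
  set a := 3 * √2 * r ^ 2 / 4 with ha
  set b := Real.exp (-(3 / 2 * L)) with hb
  have hb0 : 0 < b := Real.exp_pos _
  have hs2 : √2 ^ 2 = 2 := Real.sq_sqrt zero_le_two
  have hs0 : 0 < √2 := by positivity
  have hs1 : 4 / 3 ≤ √2 := Real.le_sqrt_of_sq_le (by norm_num)
  have hs3 : √2 ≤ 2 := by nlinarith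
  have ha0 : 0 < a := by positivity
  have hr2 : r ^ 2 = Real.exp (-(2 * L)) := by rw [hr, sq, ← Real.exp_add]; ring_nf
  have har : r ^ 2 ≤ a := by rw [ha]; nlinarith [sq_nonneg r]
  have har' : a ≤ 2 * r ^ 2 := by rw [ha]; nlinarith [sq_nonneg r]
  have hlog2 := Real.log_two_lt_d9
  have hΛ1 : L / 2 - Real.log 2 ≤ Real.log (b / a) := by
    rw [Real.log_div hb0.ne' ha0.ne', hb, Real.log_exp]
    have := Real.log_le_log ha0 har'
    rw [Real.log_mul two_ne_zero (by positivity), hr2, Real.log_exp] at this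
    linarith
  have hΛ2 : Real.log (b / a) ≤ L / 2 := by
    rw [Real.log_div hb0.ne' ha0.ne', hb, Real.log_exp]
    have := Real.log_le_log (by positivity) har
    rw [hr2, Real.log_exp] at this
    linarith
  have hab : a < b := by
    rw [← one_lt_div ha0, ← Real.log_pos_iff (by positivity)]
    linarith
  have hlow : ∀ s ∈ Icc a b, 1 / 4 * L ≤ Real.log (Real.exp 1 + 2 / (s * Real.log (b / a))) ∧
      Real.log (Real.exp 1 + 2 / (s * Real.log (b / a))) ≤ 3 * L := fun s hs => by
    have hs0 : 0 < s := ha0.trans_le hs.1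
    have hΛ : 1 ≤ Real.log (b / a) := by linarith
    set Λ := Real.log (b / a)
    constructor
    · rw [Real.le_log_iff_exp_le (by positivity)]
      have h1 : s * Λ ≤ 2 * Real.exp (-(1 / 4 * L)) := by
        calc s * Λ ≤ b * (L / 2) := by gcongr; exact hs.2
          _ ≤ b * (2 * Real.exp (L / 4)) := by
              gcongr; linarith [Real.add_one_le_exp (L / 4)]
          _ = 2 * Real.exp (-(5 / 4 * L)) := by
              rw [hb, mul_left_comm, ← Real.exp_add]; ring_nf
          _ ≤ _ := by gcongr; linarith
      have h2 : Real.exp (1 / 4 * L) ≤ 2 / (s * Λ) := by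
        rw [le_div_iff₀ (by positivity)]
        calc _ ≤ Real.exp (1 / 4 * L) * (2 * Real.exp (-(1 / 4 * L))) := by gcongr
          _ = 2 := by rw [mul_left_comm, ← Real.exp_add]; simp
          _ ≤ 2 := le_rfl
      linarith [Real.exp_pos 1]
    · rw [Real.log_le_iff_le_exp (by positivity)]
      have h1 : 2 / (s * Λ) ≤ 2 * Real.exp (2 * L) := by
        rw [div_le_iff₀ (by positivity)]
        calc (2 : ℝ) = 2 * (Real.exp (2 * L) * r ^ 2) := by rw [hr2, ← Real.exp_add]; simp
          _ ≤ 2 * (Real.exp (2 * L) * (s * 1)) := by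
              rw [mul_one]; gcongr; exact har.trans hs.1
          _ = 2 * Real.exp (2 * L) * (s * 1) := by ring
          _ ≤ _ := by gcongr
      have h2 : Real.exp 1 ≤ Real.exp (2 * L) := Real.exp_le_exp.2 (by linarith)
      have h3 := Real.add_one_le_exp L
      calc _ ≤ 3 * Real.exp (2 * L) := by linarith
        _ ≤ Real.exp L * Real.exp (2 * L) := by gcongr; linarith
        _ = _ := by rw [← Real.exp_add]; ring_nf
  have hmain := hK a b L ha0 hab hL0 (by linarith) hlow
  have hLk : 0 < L ^ (lam - k) := by positivity
  have hΨB : (volume : Measure ((Fin k → ℝ) × ℝ)).real (closedBall 0 b) *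
      orliczPsi (k + 1) lam (8 / r) ≤ B * L ^ (lam - k) := by
    have hvol : (volume : Measure ((Fin k → ℝ) × ℝ)).real (closedBall 0 b) = b ^ (k + 1) * v := by
      rw [Measure.addHaar_real_closedBall _ _ hb0.le, finrank_pi_prod]
    have hlog : Real.log (Real.exp 1 + 8 / r) ≤ 2 * L := by
      rw [Real.log_le_iff_le_exp (by positivity), hr, Real.exp_neg, div_inv_eq_mul]
      have h2 : Real.exp 1 ≤ Real.exp L := Real.exp_le_exp.2 (by linarith)
      have h3 : 9 ≤ Real.exp L := by linarith [Real.add_one_le_exp L]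
      calc _ ≤ 9 * Real.exp L := by linarith
        _ ≤ Real.exp L * Real.exp L := by gcongr
        _ = _ := by rw [← Real.exp_add]; ring_nf
    have hlog0 : 0 ≤ Real.log (Real.exp 1 + 8 / r) :=
      zero_le_one.trans (one_le_log_exp_one_add (by positivity))
    -- The linear part costs `b ^ (k + 1) * Ψ (8 / r)`, about `(b / r) ^ (k + 1) * L ^ lam`. As `b /
    -- r = exp (-(L / 2))`, the exponential beats the surplus `L ^ k`; this is where the factor `2 ^
    -- k * k!` of `B` comes from.
    have hbr : (b / r) ^ (k + 1) * L ^ k ≤ 2 ^ k * k.factorial := by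
      have h1 : b / r = Real.exp (-(L / 2)) := by rw [hb, hr, ← Real.exp_sub]; ring_nf
      have h2 : (L / 2) ^ k ≤ k.factorial * Real.exp (L / 2) := by
        have := Real.pow_div_factorial_le_exp (L / 2) (by positivity) k
        rwa [div_le_iff₀ (by positivity), mul_comm] at this
      have h3 : Real.exp (-(L / 2)) ^ (k + 1) ≤ Real.exp (-(L / 2)) := by
        refine pow_le_of_le_one (Real.exp_pos _).le ?_ (by positivity)
        rw [Real.exp_le_one_iff]; linarith
      calc _ = (Real.exp (-(L / 2))) ^ (k + 1) * (2 ^ k * (L / 2) ^ k) := by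
            rw [h1, ← mul_pow]; ring_nf
        _ ≤ Real.exp (-(L / 2)) * (2 ^ k * (k.factorial * Real.exp (L / 2))) := by gcongr
        _ = 2 ^ k * k.factorial * (Real.exp (-(L / 2)) * Real.exp (L / 2)) := by ring
        _ = _ := by rw [← Real.exp_add]; simp
    have hv : 0 ≤ v := measureReal_nonneg
    have hsplit : L ^ lam = L ^ k * L ^ (lam - k) := by
      rw [Real.rpow_sub hL0, Real.rpow_natCast]; field_simp
    rw [hvol, orliczPsi, show (k : ℝ) + 1 = ((k + 1 : ℕ) : ℝ) by push_cast; ring,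
      Real.rpow_natCast]
    calc _ ≤ b ^ (k + 1) * v * ((8 / r) ^ (k + 1) * (2 * L) ^ lam) := by gcongr
      _ = v * (8 ^ (k + 1) * 2 ^ lam) * ((b / r) ^ (k + 1) * L ^ k) * L ^ (lam - k) := by
          rw [Real.mul_rpow zero_le_two hL0.le, hsplit, div_pow, div_pow]; ring
      _ ≤ _ := by rw [hBdef]; gcongr
  have hfin := isHoleBump_thin (orliczPsi_zero hp0.ne' lam) (fun t => orliczPsi_nonneg _ _)
    (measurable_orliczPsi _ _) hr0 (by positivity) (by positivity) he₀ ha0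
    (fun j hj => by rw [he j hj, ha]; nlinarith [mul_pos hs0 (pow_pos hr0 2)]) hab
    (logProfile_left ha0) (logProfile_right ha0 hab)
    (fun s hs => hasStrictDerivAt_logProfile ha0 hab hs)
    (fun s hs => logProfile_deriv_pos ha0 hab hs) (by fun_prop) hΨB hmain
  have hsum : 2 * (K + B) * (r * L ^ (lam - k)) =
      2 * r * (K * L ^ (lam - k) + B * L ^ (lam - k)) := by ring
  rw [hsum]
  exact ⟨hab, _, hfin⟩

theorem thinBump_eq_zero {j₀ : Fin (k + 1)} {r a b : ℝ} (hr : 0 < r) (ha : 0 < a) (hab : a < b)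
    {z : (Fin (k + 1) → ℝ) × ℝ} (hz : r ≤ |z.1 j₀| ∨ ∃ j ≠ j₀, b ≤ |z.1 j|) :
    thinBump j₀ r a b z = 0 := by
  have hr34 : 3 * r / 4 ≤ r := by linarith
  set h₁ : ℝ → ℝ := fun s => (s - 3 * r / 4) * (4 / r) with hh₁
  have e1 : h₁ r = 1 := by
    have := hr.ne'
    simp only [hh₁]
    field_simp
    ring
  have hm1 : Monotone h₁ := fun s t hst => by
    simp only [hh₁]
    gcongr
  have hm2 := (strictMonoOn_of_hasStrictDerivAt_pos
    (fun s hs => hasStrictDerivAt_logProfile ha hab hs)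
    (fun s hs => logProfile_deriv_pos ha hab hs)).monotoneOn
  rw [thinBump]
  rcases hz with hz | ⟨j, hj, hz⟩
  · have hz' : r ≤ ‖(splitAt j₀ z).1‖ := hz
    rw [radialBump_of_ge hr34 e1 hz', min_eq_left]
    exact radialBump_nonneg hab.le hm2 (logProfile_right ha hab) _
  · have : b ≤ ‖(splitAt j₀ z).2‖ := by
      obtain ⟨i, rfl⟩ := Fin.exists_succAbove_eq hj
      exact hz.trans ((norm_le_pi_norm (splitAt j₀ z).2.1 i).trans (norm_fst_le _))
    rw [radialBump_of_ge hab.le (logProfile_right ha hab) this, min_eq_right]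
    exact radialBump_nonneg hr34 (hm1.monotoneOn _) e1 _

theorem thinBump_lt_one {j₀ : Fin (k + 1)} {r a b : ℝ} (hr : 0 < r) (ha : 0 < a) (hab : a < b)
    {z : (Fin (k + 1) → ℝ) × ℝ} (hz : r ≤ |z.1 j₀| ∨ ∃ j ≠ j₀, a < |z.1 j|) :
    thinBump j₀ r a b z < 1 := by
  rcases hz with hz | ⟨j, hj, hz⟩
  · rw [thinBump_eq_zero hr ha hab (Or.inl hz)]
    exact one_pos
  · have : a < ‖(splitAt j₀ z).2‖ := by
      obtain ⟨i, rfl⟩ := Fin.exists_succAbove_eq hj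
      exact hz.trans_le ((norm_le_pi_norm (splitAt j₀ z).2.1 i).trans (norm_fst_le _))
    exact (min_le_right _ _).trans_lt (radialBump_lt_one hab.le
      (strictMonoOn_of_hasStrictDerivAt_pos (fun s hs => hasStrictDerivAt_logProfile ha hab hs)
        (fun s hs => logProfile_deriv_pos ha hab hs)) (logProfile_left ha) hab this)

theorem volume_setOf_abs_inner_le {m : ℕ} (Q : OpenRectangle m) (δ : Fin m → ℝ) :
    volume {y | ∀ j, |inner ℝ (Q.frame j) (y - Q.center)| ≤ δ j} =
      ∏ j, ENNReal.ofReal (2 * δ j) := by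
  have h1 : MeasurePreserving (fun y : EuclideanSpace ℝ (Fin m) => y - Q.center) volume volume :=
    measurePreserving_sub_right volume Q.center
  have h2 := (PiLp.volume_preserving_ofLp (Fin m)).comp (Q.frame.measurePreserving_repr.comp h1)
  have h3 : {y | ∀ j, |inner ℝ (Q.frame j) (y - Q.center)| ≤ δ j} =
      (WithLp.ofLp ∘ Q.frame.repr ∘ fun y : EuclideanSpace ℝ (Fin m) => y - Q.center) ⁻¹'
        (univ.pi fun j => closedBall 0 (δ j)) := by
    ext y
    simp only [mem_ofPred_eq, mem_preimage, mem_univ_pi, mem_closedBall_zero_iff, Real.norm_eq_abs,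
      Function.comp_apply, OrthonormalBasis.repr_apply_apply]
  rw [h3, h2.measure_preimage
    (MeasurableSet.univ_pi fun j => measurableSet_closedBall).nullMeasurableSet, volume_pi_pi]
  simp only [Real.volume_closedBall]

end ThinCase

/-! ### Non-removability when the holes are thin rectangles -/

section MainTheorem

/-- Outside `2Q` a bump is only `< 1`, so its vanishing for all but finitely many holes has to come
from Borel-Cantelli, and holds almost everywhere on `S`. -/
theorem not_isPLRemovable_thin {k : ℕ} {lam : ℝ} (hlam : k < lam)
    {ι : Type*} [Countable ι] {Q : ι → OpenRectangle (k + 1)}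
    {E : Set (EuclideanSpace ℝ (Fin (k + 1)))} (hE : IsCompact E)
    (hdisj : Pairwise fun i j => Disjoint (Q i).toSet (Q j).toSet)
    (hcompl : openUnitCube (k + 1) \ E = ⋃ i, (Q i).toSet) (hthin : ∀ i, ∃ r, (Q i).IsThin r)
    (hS : volume (openUnitCube (k + 1) \ ⋃ i, (Q i).dilate 2) ≠ 0)
    (hsum : Summable fun i => (Q i).diam * Real.log (1 / (Q i).diam) ^ (lam - k)) :
    ¬ IsPLRemovable (k + 2) (k + 1) lam E := by
  choose r j₀ hj₀ hj using hthin
  have hr0 : ∀ i, 0 < r i := fun i => hj₀ i ▸ (Q i).edge_pos _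
  have hs2 : √2 ^ 2 = 2 := Real.sq_sqrt zero_le_two
  have hs0 : 0 < √2 := by positivity
  have hrlim : Tendsto r cofinite (𝓝 0) := by
    refine tendsto_order.2 ⟨fun c hc => Eventually.of_forall fun i => hc.trans (hr0 i),
      fun c hc => ?_⟩
    -- `r i ≥ c` bounds every edge below by this minimum, which happens for finitely many
    -- rectangles.
    have hc' : 0 < min c (√2 * c ^ 2) := lt_min hc (by positivity)
    refine (finite_setOf_forall_le_edge hdisj hcompl hc').subset fun i hi j => ?_
    have hci : c ≤ r i := not_lt.1 hi
    by_cases h : j = j₀ i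
    · rw [h, hj₀ i]
      exact (min_le_left _ _).trans hci
    · rw [hj i j h]
      exact (min_le_right _ _).trans (by gcongr)
  have hL : Tendsto (fun i => Real.log (1 / r i)) cofinite atTop := by
    simp only [one_div]
    exact Real.tendsto_log_atTop.comp (tendsto_inv_nhdsGT_zero.comp
      (tendsto_nhdsWithin_iff.2 ⟨hrlim, Eventually.of_forall hr0⟩))
  have hrd : ∀ i, r i ≤ (Q i).diam := fun i => hj₀ i ▸ (Q i).edge_le_diam _
  have hdL : ∀ᶠ i in cofinite, Real.log (1 / r i) ≤ 2 * Real.log (1 / (Q i).diam) := by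
    -- `r < 1 / 2` makes the long edge the largest, so the diameter is at most `√(k + 1) * r`; the
    -- second condition absorbs `log √(k + 1)` into half of `log (1 / r)`.
    filter_upwards [hrlim.eventually (gt_mem_nhds (by norm_num : (0 : ℝ) < 1 / 2)),
      hL.eventually_ge_atTop (2 * Real.log √((k + 1 : ℕ) : ℝ))] with i hi hi2
    have hd : (Q i).diam ≤ √((k + 1 : ℕ) : ℝ) * r i := by
      refine (Q i).diam_le (hr0 i).le fun j => ?_
      by_cases h : j = j₀ i
      · rw [h, hj₀ i]
      · rw [hj i j h]
        have hs3 : √2 ≤ 2 := by nlinarith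
        calc √2 * r i ^ 2 ≤ 2 * r i ^ 2 := by gcongr
          _ ≤ r i := by nlinarith [hr0 i]
    have h1 := Real.log_le_log ((hr0 i).trans_le (hrd i)) hd
    have hpos : 0 < √((k + 1 : ℕ) : ℝ) := by positivity
    rw [Real.log_mul hpos.ne' (hr0 i).ne'] at h1
    rw [one_div, Real.log_inv] at hi2 ⊢
    rw [one_div, Real.log_inv]
    linarith
  have hlamk : 0 < lam - k := by linarith
  -- As `lam > k`, the logarithmic factor is eventually at least `1`, and `r` is at most the
  -- diameter.
  have hrsum : Summable r := by
    refine Summable.of_norm_bounded_eventually hsum ?_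
    filter_upwards [hdL, hL.eventually_ge_atTop 2] with i h1 h2
    rw [Real.norm_eq_abs, abs_of_pos (hr0 i)]
    have h3 : 1 ≤ Real.log (1 / (Q i).diam) ^ (lam - k) :=
      Real.one_le_rpow (by linarith) hlamk.le
    exact (hrd i).trans (le_mul_of_one_le_right ((hr0 i).le.trans (hrd i)) h3)
  obtain ⟨K, L₀, hK0, hK⟩ := exists_isHoleBump_thin k hlam
  set a : ι → ℝ := fun i => 3 * √2 * r i ^ 2 / 4 with ha
  set b : ι → ℝ := fun i => Real.exp (-(3 / 2 * Real.log (1 / r i))) with hb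
  have ha0 : ∀ i, 0 < a i := fun i => by
    have := hr0 i
    positivity
  have hbump : ∀ᶠ i in cofinite, a i < b i ∧ ∃ g, IsHoleBump (orliczPsi (k + 1) lam) (Q i).edge
      (thinBump (j₀ i) (r i) (a i) (b i)) g (b i)
      (K * 2 ^ (lam - k) * ((Q i).diam * Real.log (1 / (Q i).diam) ^ (lam - k))) := by
    filter_upwards [hL.eventually_ge_atTop L₀, hdL, hL.eventually_ge_atTop 0] with i h1 h2 h3
    obtain ⟨hab, g, hg⟩ := hK (Q i).edge (j₀ i) (r i) (Real.log (1 / r i)) (hj₀ i) (hj i)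
      (exp_neg_log_one_div (hr0 i)).symm h1
    refine ⟨hab, g, { hg with energy := hg.energy.trans (ENNReal.ofReal_le_ofReal ?_) }⟩
    have h4 : Real.log (1 / r i) ^ (lam - k) ≤
        2 ^ (lam - k) * Real.log (1 / (Q i).diam) ^ (lam - k) := by
      rw [← Real.mul_rpow zero_le_two (by linarith)]
      exact Real.rpow_le_rpow h3 h2 hlamk.le
    have h5 := (hr0 i).le
    calc _ ≤ K * ((Q i).diam * (2 ^ (lam - k) * Real.log (1 / (Q i).diam) ^ (lam - k))) := by
          have h6 : 0 ≤ 2 ^ (lam - k) * Real.log (1 / (Q i).diam) ^ (lam - k) := by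
            have : 0 ≤ Real.log (1 / (Q i).diam) := by linarith
            positivity
          refine mul_le_mul_of_nonneg_left ?_ hK0
          exact mul_le_mul (hrd i) h4 (by positivity) (h5.trans (hrd i))
      _ = _ := by ring
  obtain ⟨g, hg⟩ := Filter.skolem.1 (hbump.mono fun i hi => hi.2)
  have hblim : Tendsto b cofinite (𝓝 0) :=
    Real.tendsto_exp_neg_atTop_nhds_zero.comp (hL.const_mul_atTop (by norm_num))
  have hcoords : ∀ i (y : EuclideanSpace ℝ (Fin (k + 1))) j,
      ((Q i).coords (hyperplaneEmb (k + 1 + 1) y)).1 j =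
      inner ℝ ((Q i).frame j) (y - (Q i).center) := fun i y j => by
    rw [OpenRectangle.coords, horizontal_hyperplaneEmb]
  refine not_isPLRemovable_of_isHoleBump (by positivity) hE hcompl hg hblim
    (hsum.mul_left _) (diff_dilate_subset hcompl fun _ => one_le_two) hS ?_ ?_
  · filter_upwards [hbump] with i hi y hy
    refine thinBump_lt_one (hr0 i) (ha0 i) hi.1 ?_
    have hout : ∃ j, (Q i).edge j ≤ |inner ℝ ((Q i).frame j) (y - (Q i).center)| := by
      by_contra! h
      exact hy.2 (mem_iUnion.2 ⟨i, fun j => (h j).trans_eq (by ring)⟩)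
    obtain ⟨j, hjy⟩ := hout
    by_cases h : j = j₀ i
    · left
      rw [hcoords, ← h]
      rwa [h, hj₀ i, ← h] at hjy
    · right
      refine ⟨j, h, ?_⟩
      rw [hcoords]
      rw [hj i j h] at hjy
      refine lt_of_lt_of_le ?_ hjy
      have := mul_pos hs0 (pow_pos (hr0 i) 2)
      simp only [ha]
      linarith
  -- The slabs of half-width `r` along the long edge and `1 / 2` in the other directions have volume
  -- `2 * r`; they contain the traces of the supports once `b < 1 / 2`.
  · have hBC : ∑' i, volume {y | ∀ j, |inner ℝ ((Q i).frame j) (y - (Q i).center)| ≤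
        if j = j₀ i then r i else 1 / 2} ≠ ⊤ := by
      refine ne_top_of_le_ne_top (hrsum.mul_left 2).tsum_ofReal_ne_top
        (ENNReal.tsum_le_tsum fun i => ?_)
      rw [volume_setOf_abs_inner_le, Finset.prod_eq_single (j₀ i)]
      · simp
      · intro j _ h
        simp [h]
      · intro h
        exact absurd (Finset.mem_univ _) h
    filter_upwards [ae_finite_setOfPred_mem hBC] with y hy _
    filter_upwards [hbump, hblim.eventually (gt_mem_nhds (by norm_num : (0 : ℝ) < 1 / 2)),
      hy.compl_mem_cofinite] with i hi hbi hyi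
    refine thinBump_eq_zero (hr0 i) (ha0 i) hi.1 ?_
    have hout : ∃ j, (if j = j₀ i then r i else 1 / 2) <
        |inner ℝ ((Q i).frame j) (y - (Q i).center)| := by
      by_contra! h
      exact hyi h
    obtain ⟨j, hjy⟩ := hout
    by_cases h : j = j₀ i
    · left
      rw [if_pos h] at hjy
      rw [hcoords, ← h]
      exact hjy.le
    · right
      rw [if_neg h] at hjy
      exact ⟨j, h, by rw [hcoords]; linarith⟩

end MainTheorem
-- Assembly of the four cases
theorem mainTheorem5 (n : ℕ) (hn : 3 ≤ n) (p lam : ℝ)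
    (E : Set (EuclideanSpace ℝ (Fin (n - 1)))) (hE : IsCompact E)
    {ι : Type*} [Countable ι] (Q : ι → OpenRectangle (n - 1))
    (hdisj : Pairwise fun i j => Disjoint (Q i).toSet (Q j).toSet)
    (hcompl : openUnitCube (n - 1) \ E = ⋃ i, (Q i).toSet)
    (hcases :
      -- case (i)
      (((1 < p ∧ p < n - 1) ∨ (p = 1 ∧ 0 ≤ lam) ∨ (n - 1 < p ∧ p < n) ∨
          (p = n - 1 ∧ lam ≤ n - 2)) ∧
        (∀ i, (Q i).IsCube) ∧
        0 < μHE[n - 1] (openUnitCube (n - 1) \ ⋃ i, (Q i).dilate 2) ∧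
        Summable fun i => (Q i).diam ^ ((n : ℝ) - p) * Real.log (1 / (Q i).diam) ^ lam) ∨
      -- case (ii)
      ((p = n - 1 ∧ n - 2 < lam) ∧
        (∀ i, ∃ r, (Q i).IsThin r) ∧
        0 < μHE[n - 1] (openUnitCube (n - 1) \ ⋃ i, (Q i).dilate 2) ∧
        Summable fun i => (Q i).diam * Real.log (1 / (Q i).diam) ^ (lam - ((n : ℝ) - 2))) ∨
      -- case (iii)
      ((p = n ∧ lam < n - 1) ∧
        (∀ i, (Q i).IsCube) ∧
        0 < μHE[n - 1] ((E ∩ openUnitCube (n - 1)) \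
          ⋃ i, (Q i).dilate ((Q i).diam ^ (-(1 / 2 : ℝ)))) ∧
        Summable fun i => Real.log (1 / (Q i).diam) ^ (lam - ((n : ℝ) - 1))) ∨
      -- case (iv)
      ((p = n ∧ lam = n - 1) ∧
        (∀ i, (Q i).IsCube) ∧
        0 < μHE[n - 1] ((E ∩ openUnitCube (n - 1)) \
          ⋃ i, (Q i).dilate ((Q i).expRadius / (Q i).diam)) ∧
        Summable fun i => Real.log (Real.log (1 / (Q i).diam)) ^ (1 - (n : ℝ)))) :
    ¬ IsPLRemovable n p lam E := by
  obtain ⟨k, rfl⟩ : ∃ k, n = k + 2 := ⟨n - 2, by omega⟩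
  have hk : (1 : ℝ) ≤ k := by exact_mod_cast (by omega : 1 ≤ k)
  have hvol : (μHE[k + 2 - 1] : Measure (EuclideanSpace ℝ (Fin (k + 2 - 1)))) = volume :=
    EuclideanSpace.euclideanHausdorffMeasure_eq_volume _
  have hn1 : ((k + 2 : ℕ) : ℝ) - 1 = k + 1 := by push_cast; ring
  have hn2 : ((k + 2 : ℕ) : ℝ) - 2 = k := by push_cast; ring
  have hn0 : ((k + 2 : ℕ) : ℝ) = ((k + 1 : ℕ) : ℝ) + 1 := by push_cast; ring
  rw [hvol, hn1, hn2] at hcases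
  rcases hcases with ⟨hp, hQ, hS, hsum⟩ | ⟨⟨hp, hl⟩, hQ, hS, hsum⟩ | ⟨⟨hp, hl⟩, hQ, hS, hsum⟩ |
    ⟨⟨hp, hl⟩, hQ, hS, hsum⟩
  · rw [hn0] at hp hsum
    push_cast at hp
    -- All four ranges in case (i) lie in `0 < p ≤ n`, the range covered by the linear bumps.
    have hp' : 0 < p ∧ p ≤ ((k + 1 : ℕ) : ℝ) + 1 := by
      push_cast
      rcases hp with h | h | h | h <;> constructor <;> linarith [h.1, h.2]
    exact not_isPLRemovable_subcritical (m := k + 1) (Nat.succ_pos k) hp'.1 hp'.2 hE hdisj hcompl hQ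
      hS.ne' hsum
  · subst hp
    exact not_isPLRemovable_thin hl hE hdisj hcompl hQ hS.ne' hsum
  · rw [hp, hn0]
    refine not_isPLRemovable_critical (m := k + 1) (Nat.succ_pos k) hE hdisj hcompl hQ hS.ne' ?_
    push_cast
    exact hsum
  · have hl' : lam = ((k + 1 : ℕ) : ℝ) := by rw [hl]; push_cast; ring
    rw [hp, hn0, hl']
    refine not_isPLRemovable_doubly_critical (m := k + 1) (Nat.succ_pos k) hE hdisj hcompl hQ
      hS.ne' ?_
    convert hsum using 3
    push_cast
    ring
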